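/- \textbf{Setting.} Let $s\ge 1$. On $\mathbb{R}^{s+1}$ put $px=p_0x_0-\sum_{j=1}^s p_jx_j$, and on $\mathbb{R}^s$ put $px=-\sum_{j=1}^s p_jx_j$. Consider a local relativistic quantum field theory, i.e. an infinite-dimensional complex Hilbert space $\mathcal{H}$ and a net $\mathcal{O}\mapsto\mathfrak{A}(\mathcal{O})\subset B(\mathcal{H})$ of unital $C^*$-algebras (containing the unit $I$ of $B(\mathcal{H})$), attached to the open bounded sets $\mathcal{O}\subset\mathbb{R}^{s+1}$, such that: $\mathfrak{A}(\mathcal{O}_1)\subset\mathfrak{A}(\mathcal{O}_2)$ if $\mathcal{O}_1\subset\mathcal{O}_2$; $\mathfrak{A}(\mathcal{O}_1)$ and $\mathfrak{A}(\mathcal{O}_2)$ commute if $\mathcal{O}_1,\mathcal{O}_2$ are spacelike separated; the norm closure $\mathfrak{A}$ of $\bigcup_{\mathcal{O}}\mathfrak{A}(\mathcal{O})$ acts irreducibly on $\mathcal{H}$; and there is a strongly continuous unitary representation $U$ of $\mathbb{R}^{s+1}$ on $\mathcal{H}$ whose joint spectrum lies in the closed forward lightcone, such that $\alpha_x(\,\cdot\,)=U(x)\,\cdot\,U(x)^*$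 satisfies $\alpha_x(\mathfrak{A}(\mathcal{O}))=\mathfrak{A}(\mathcal{O}+x)$ and $x\mapsto\alpha_x(A)$ is norm continuous for every $A\in\mathfrak{A}$. Suppose that there is a unit vector $\Omega\in\mathcal{H}$ with $U(x)\Omega=\Omega$ for all $x$, and set $\omega_0(A)=(\Omega|A\Omega)$. Let $\mathfrak{A}_*=B(\mathcal{H})_*\subset\mathfrak{A}^*$ be the space of (restrictions to $\mathfrak{A}$ of) normal functionals, with the transposed action $\alpha_x^*\varphi=\varphi\circ\alpha_x$, and let $\beta_{\vec x}=\alpha_{(0,\vec x)}$, $\vec x\in\mathbb{R}^s$. Fix $0<\varepsilon<1$ and put $K_L=[-L^\varepsilon,L^\varepsilon]\times[-L,L]^s$ for $\alpha$ ($d=s+1$) and $K_L=[-L,L]^s$ for $\beta$ ($d=s$). \textbf{Spectral notions} (written for $\alpha$; likewise for $\beta$). For $\varphi\in\mathfrak{A}_*$, $A\in\mathfrak{A}$ let $\varphi(\widetilde{A}(p))=(2\pi)^{-d/2}\int d^dx\,e^{-ipx}\varphi(\alpha_x(A))$, a tempered distribution in $p$. Put $\mathrm{Sp}\,\alpha=\overline{\bigcup_{A\in\mathfrak{A},\,\varphi\in\mathfrak{A}_*}\mathrm{supp}\,\varphi(\widetilde{A}(\cdot))}$;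 $\widetilde{\mathfrak{A}}(\{q\})=\{A\in\mathfrak{A}\mid \mathrm{supp}\,\varphi(\widetilde{A}(\cdot))\subset\{q\}\ \forall\varphi\in\mathfrak{A}_*\}$; $\mathfrak{A}_{\mathrm{pp}}$ is the norm closure of the span of the sets $\widetilde{\mathfrak{A}}(\{q\})$, $q\in\mathrm{Sp}\,\alpha$; $$\mathfrak{A}_{\mathrm{c}}=\Big\{A\in\mathfrak{A}\ \Big|\ \lim_{L\to\infty}\frac{1}{|K_L|}\int_{K_L}e^{-iqx}\varphi(\alpha_x(A))\,d^dx=0\ \ \forall q\in\mathbb{R}^d,\ \varphi\in\mathfrak{A}_*\Big\};$$ and $\mathrm{Sp}_{\mathrm{c}}\alpha=\overline{\bigcup_{A\in\mathfrak{A}_{\mathrm{c}},\,\varphi\in\mathfrak{A}_*}\mathrm{supp}\,\varphi(\widetilde{A}(\cdot))}$. The objects $\mathfrak{A}_{*,\mathrm{pp}}$, $\mathfrak{A}_{*,\mathrm{c}}$, $\mathrm{Sp}_{\mathrm{c}}\alpha^*$ are defined in the same way for the action $\alpha^*$ on $\mathfrak{A}_*$, with the roles of $\mathfrak{A}$ and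 $\mathfrak{A}_*$ exchanged. \textbf{Theorem.} $\ker\omega_0\subset\mathfrak{A}_{\mathrm{c}}$ and, consequently, (a) $\mathfrak{A}=\mathfrak{A}_{\mathrm{pp}}\oplus\mathfrak{A}_{\mathrm{c}}$, where $\mathfrak{A}_{\mathrm{pp}}=\mathrm{Span}\{I\}$ and $\mathfrak{A}_{\mathrm{c}}=\ker\omega_0$; (b) $\mathfrak{A}_*=\mathfrak{A}_{*,\mathrm{pp}}\oplus\mathfrak{A}_{*,\mathrm{c}}$, where $\mathfrak{A}_{*,\mathrm{pp}}=\mathrm{Span}\{\omega_0\}$ and $\mathfrak{A}_{*,\mathrm{c}}=\ker I=\{\varphi\in\mathfrak{A}_*\mid\varphi(I)=0\}$; (c) $\mathrm{Sp}_{\mathrm{c}}\alpha=\mathrm{Sp}_{\mathrm{c}}\alpha^*$. The same statements hold for the group $\beta$ of space translations. -/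

import Mathlib

open MeasureTheory Filter Topology
open scoped ContDiff

noncomputable section

/-! ### Fourier transforms and supports -/

/-- The Fourier transform `(2π)^{-d/2} ∫ dx e^{-ipx} F(x)` of a bounded continuous function `F`,
as a tempered distribution in `p`, evaluated on the test function `g`; `px` is `B p x`. -/
def fourierPairing {d : ℕ} (B : LinearMap.BilinForm ℝ (Fin d → ℝ)) (F g : (Fin d → ℝ) → ℂ) : ℂ :=
  (((2 * Real.pi) ^ (-(d : ℝ) / 2) : ℝ) : ℂ) *
    ∫ x : Fin d → ℝ, F x * ∫ p : Fin d → ℝ, Complex.exp (-Complex.I * (B p x : ℝ)) * g p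

/-- The support of the distribution `fourierPairing B F`: the points all of whose open
neighbourhoods carry a test function on which the distribution does not vanish. -/
def fourierSupport {d : ℕ} (B : LinearMap.BilinForm ℝ (Fin d → ℝ)) (F : (Fin d → ℝ) → ℂ) :
    Set (Fin d → ℝ) :=
  {p | ∀ V : Set (Fin d → ℝ), IsOpen V → p ∈ V →
    ∃ g : (Fin d → ℝ) → ℂ, ContDiff ℝ ∞ g ∧ HasCompactSupport g ∧ tsupport g ⊆ V ∧
      fourierPairing B F g ≠ 0}

/-! ### Spectral theory of groups of isometries -/

/-- A group of isometries `x ↦ act x` of `E`, indexed by `ℝ^d`, together with a space `F` which is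
paired with `E`, such that all functions `x ↦ ⟨φ, act x A⟩` are continuous. -/
structure IsometryGroup (d : ℕ) (E F : Type*) [NormedAddCommGroup E] [NormedSpace ℂ E]
    [NormedAddCommGroup F] [NormedSpace ℂ F] where
  act : (Fin d → ℝ) → E →ₗᵢ[ℂ] E
  act_zero : ∀ A, act 0 A = A
  act_add : ∀ x y A, act (x + y) A = act x (act y A)
  pairing : F →ₗ[ℂ] E →ₗ[ℂ] ℂ
  norm_pairing_le : ∀ φ A, ‖pairing φ A‖ ≤ ‖φ‖ * ‖A‖
  continuous_pairing : ∀ φ A, Continuous fun x => pairing φ (act x A)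

namespace IsometryGroup

variable {d : ℕ} {E F : Type*} [NormedAddCommGroup E] [NormedSpace ℂ E]
    [NormedAddCommGroup F] [NormedSpace ℂ F]

/-- The Arveson spectrum of the restriction of the group to a subspace `S`. -/
def spectrumOn (α : IsometryGroup d E F) (B : LinearMap.BilinForm ℝ (Fin d → ℝ))
    (S : Submodule ℂ E) : Set (Fin d → ℝ) :=
  closure (⋃ A ∈ S, ⋃ φ : F, fourierSupport B fun x => α.pairing φ (α.act x A))

/-- The Arveson spectrum. -/
def spectrum (α : IsometryGroup d E F) (B : LinearMap.BilinForm ℝ (Fin d → ℝ)) :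
    Set (Fin d → ℝ) :=
  α.spectrumOn B ⊤

/-- The spectral subspace of a (closed) set `Δ`. -/
def spectralSubspace (α : IsometryGroup d E F) (B : LinearMap.BilinForm ℝ (Fin d → ℝ))
    (Δ : Set (Fin d → ℝ)) : Set E :=
  {A | ∀ φ : F, fourierSupport B (fun x => α.pairing φ (α.act x A)) ⊆ Δ}

/-- The pure-point subspace. -/
def purePointSubspace (α : IsometryGroup d E F) (B : LinearMap.BilinForm ℝ (Fin d → ℝ)) :
    Submodule ℂ E :=
  (Submodule.span ℂ (⋃ q ∈ α.spectrum B, α.spectralSubspace B {q})).topologicalClosure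

/-- The mean of `x ↦ e^{-iqx} ⟨φ, act x A⟩` over the cuboid centred at zero whose half edge
lengths are the entries of `l`. -/
def mean (α : IsometryGroup d E F) (B : LinearMap.BilinForm ℝ (Fin d → ℝ)) (l q : Fin d → ℝ)
    (φ : F) (A : E) : ℂ :=
  (((volume (Set.Icc (-l) l)).toReal⁻¹ : ℝ) : ℂ) *
    ∫ x in Set.Icc (-l) l, Complex.exp (-Complex.I * (B q x : ℝ)) * α.pairing φ (α.act x A)

theorem integrableOn_mean (α : IsometryGroup d E F) (B : LinearMap.BilinForm ℝ (Fin d → ℝ))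
    (l q : Fin d → ℝ) (φ : F) (A : E) :
    IntegrableOn (fun x => Complex.exp (-Complex.I * (B q x : ℝ)) * α.pairing φ (α.act x A))
      (Set.Icc (-l) l) := by
  have h : Continuous fun x => B q x := (B q).continuous_of_finiteDimensional
  have h' := α.continuous_pairing φ A
  exact (Continuous.continuousOn (by fun_prop)).integrableOn_compact isCompact_Icc

/-- The continuous subspace, with respect to the family of cuboids centred at zero with half edge
lengths `l L`, as `L → ∞`. -/
def continuousSubspace (α : IsometryGroup d E F) (B : LinearMap.BilinForm ℝ (Fin d → ℝ))
    (l : ℝ → Fin d → ℝ) : Submodule ℂ E where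
  carrier := {A | ∀ (q : Fin d → ℝ) (φ : F),
    Tendsto (fun L : ℝ => α.mean B (l L) q φ A) atTop (𝓝 0)}
  zero_mem' := by
    intro q φ
    simp [mean]
  add_mem' := by
    intro a b ha hb q φ
    have h := (ha q φ).add (hb q φ)
    rw [add_zero] at h
    refine h.congr fun L => ?_
    simp only [mean]
    rw [← mul_add, ← integral_add (α.integrableOn_mean B _ q φ a) (α.integrableOn_mean B _ q φ b)]
    simp only [map_add, mul_add]
  smul_mem' := by
    intro c a ha q φ
    have h := (ha q φ).const_mul c
    rw [mul_zero] at h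
    refine h.congr fun L => ?_
    simp only [mean]
    rw [mul_left_comm, ← integral_const_mul]
    simp only [map_smul, smul_eq_mul, mul_left_comm]

/-- The continuous spectrum. -/
def continuousSpectrum (α : IsometryGroup d E F) (B : LinearMap.BilinForm ℝ (Fin d → ℝ))
    (l : ℝ → Fin d → ℝ) : Set (Fin d → ℝ) :=
  α.spectrumOn B (α.continuousSubspace B l)

/-- The subgroup obtained by restriction along a linear map of the parameter spaces. -/
def restrict {k : ℕ} (α : IsometryGroup d E F) (j : (Fin k → ℝ) →ₗ[ℝ] (Fin d → ℝ)) :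
    IsometryGroup k E F where
  act x := α.act (j x)
  act_zero A := by rw [map_zero, α.act_zero]
  act_add x y A := by rw [map_add, α.act_add]
  pairing := α.pairing
  norm_pairing_le := α.norm_pairing_le
  continuous_pairing φ A :=
    (α.continuous_pairing φ A).comp j.continuous_of_finiteDimensional

/-- The group of isometries `act` of `E`, considered with a subspace `N` of the dual. -/
def ofDualSubspace (act : (Fin d → ℝ) → E →ₗᵢ[ℂ] E) (h0 : ∀ A, act 0 A = A)
    (hadd : ∀ x y A, act (x + y) A = act x (act y A))
    (hcont : ∀ A, Continuous fun x => act x A) (N : Submodule ℂ (StrongDual ℂ E)) :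
    IsometryGroup d E N where
  act := act
  act_zero := h0
  act_add := hadd
  pairing := (ContinuousLinearMap.coeLM ℂ).comp N.subtype
  norm_pairing_le φ A := (φ : StrongDual ℂ E).le_opNorm A
  continuous_pairing φ A := (φ : StrongDual ℂ E).continuous.comp (hcont A)

theorem norm_comp_act (act : (Fin d → ℝ) → E →ₗᵢ[ℂ] E) (h0 : ∀ A, act 0 A = A)
    (hadd : ∀ x y A, act (x + y) A = act x (act y A)) (x : Fin d → ℝ) (φ : StrongDual ℂ E) :
    ‖φ.comp (act x).toContinuousLinearMap‖ = ‖φ‖ := by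
  refine le_antisymm ?_ ?_
  · refine ContinuousLinearMap.opNorm_le_bound _ (norm_nonneg φ) fun A => ?_
    have h := φ.le_opNorm (act x A)
    rwa [LinearIsometry.norm_map] at h
  · refine ContinuousLinearMap.opNorm_le_bound _
      (norm_nonneg (φ.comp (act x).toContinuousLinearMap)) fun A => ?_
    have h := (φ.comp (act x).toContinuousLinearMap).le_opNorm (act (-x) A)
    have e : act x (act (-x) A) = A := by rw [← hadd, add_neg_cancel, h0]
    rw [LinearIsometry.norm_map] at h
    change ‖φ (act x (act (-x) A))‖ ≤ _ at h
    rwa [e] at h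

/-- The transposed action `φ ↦ φ ∘ act x` on an invariant subspace `N` of the dual of `E`, with the
roles of `E` and `N` exchanged. -/
def transpose (act : (Fin d → ℝ) → E →ₗᵢ[ℂ] E) (h0 : ∀ A, act 0 A = A)
    (hadd : ∀ x y A, act (x + y) A = act x (act y A))
    (hcont : ∀ A, Continuous fun x => act x A) (N : Submodule ℂ (StrongDual ℂ E))
    (hN : ∀ x, ∀ φ ∈ N, φ.comp (act x).toContinuousLinearMap ∈ N) :
    IsometryGroup d N E where
  act x :=
    { toFun := fun φ => ⟨(φ : StrongDual ℂ E).comp (act x).toContinuousLinearMap, hN x φ φ.2⟩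
      map_add' := fun _ _ => rfl
      map_smul' := fun _ _ => rfl
      norm_map' := fun φ => norm_comp_act act h0 hadd x (φ : StrongDual ℂ E) }
  act_zero φ := by
    refine Subtype.ext (ContinuousLinearMap.ext fun A => ?_)
    change (φ : StrongDual ℂ E) (act 0 A) = (φ : StrongDual ℂ E) A
    rw [h0]
  act_add x y φ := by
    refine Subtype.ext (ContinuousLinearMap.ext fun A => ?_)
    change (φ : StrongDual ℂ E) (act (x + y) A) = (φ : StrongDual ℂ E) (act y (act x A))
    rw [add_comm, hadd]
  pairing := ((ContinuousLinearMap.coeLM ℂ).comp N.subtype).flip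
  norm_pairing_le A φ := by
    rw [mul_comm]
    exact (φ : StrongDual ℂ E).le_opNorm A
  continuous_pairing A φ := (φ : StrongDual ℂ E).continuous.comp (hcont A)

end IsometryGroup

/-! ### Minkowski space -/

/-- The Minkowski product `p₀x₀ - ∑ pⱼxⱼ` on `ℝ^{s+1}`; the coordinate `0` is time. -/
def minkowskiForm (s : ℕ) : LinearMap.BilinForm ℝ (Fin (s + 1) → ℝ) :=
  LinearMap.mk₂ ℝ (fun p x => p 0 * x 0 - ∑ j : Fin s, p j.succ * x j.succ)
    (fun p p' x => by simp only [Pi.add_apply, add_mul, Finset.sum_add_distrib]; ring)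
    (fun c p x => by simp only [Pi.smul_apply, smul_eq_mul, mul_sub, Finset.mul_sum, mul_assoc])
    (fun p x x' => by simp only [Pi.add_apply, mul_add, Finset.sum_add_distrib]; ring)
    (fun c p x => by
      simp only [Pi.smul_apply, smul_eq_mul, mul_sub, Finset.mul_sum, mul_left_comm])

/-- The restriction `-∑ pⱼxⱼ` of the Minkowski product to space. -/
def spaceForm (s : ℕ) : LinearMap.BilinForm ℝ (Fin s → ℝ) :=
  LinearMap.mk₂ ℝ (fun p x => -∑ j : Fin s, p j * x j)
    (fun p p' x => by simp only [Pi.add_apply, add_mul, Finset.sum_add_distrib]; ring)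
    (fun c p x => by simp only [Pi.smul_apply, smul_eq_mul, mul_neg, Finset.mul_sum, mul_assoc])
    (fun p x x' => by simp only [Pi.add_apply, mul_add, Finset.sum_add_distrib]; ring)
    (fun c p x => by
      simp only [Pi.smul_apply, smul_eq_mul, mul_neg, Finset.mul_sum, mul_left_comm])

/-- The embedding `x ↦ (0, x)` of space into spacetime. -/
def spaceEmbedding (s : ℕ) : (Fin s → ℝ) →ₗ[ℝ] (Fin (s + 1) → ℝ) where
  toFun x := Fin.cons 0 x
  map_add' x y := by
    funext i
    refine Fin.cases ?_ (fun j => ?_) i <;> simp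
  map_smul' c x := by
    funext i
    refine Fin.cases ?_ (fun j => ?_) i <;> simp

/-- The closed forward lightcone. -/
def closedForwardCone (s : ℕ) : Set (Fin (s + 1) → ℝ) :=
  {p | 0 ≤ p 0 ∧ 0 ≤ minkowskiForm s p p}

/-- Every point of `O₁` is spacelike to every point of `O₂`. -/
def SpacelikeSeparated {s : ℕ} (O₁ O₂ : Set (Fin (s + 1) → ℝ)) : Prop :=
  ∀ x ∈ O₁, ∀ y ∈ O₂, minkowskiForm s (x - y) (x - y) < 0

/-- The half edge lengths of `[-L^ε, L^ε] × [-L, L]^s`. -/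
def spacetimeEdges (s : ℕ) (ε L : ℝ) : Fin (s + 1) → ℝ := Fin.cons (L ^ ε) fun _ => L

/-- The half edge lengths of `[-L, L]^s`. -/
def spaceEdges (s : ℕ) (L : ℝ) : Fin s → ℝ := fun _ => L

/-! ### Operators on a Hilbert space -/

section Operators

variable {H : Type*} [NormedAddCommGroup H] [InnerProductSpace ℂ H] [CompleteSpace H]

/-- The operators in `M` leave no closed subspace invariant apart from `0` and `H`. -/
def ActsIrreducibly (M : StarSubalgebra ℂ (H →L[ℂ] H)) : Prop :=
  ∀ W : Submodule ℂ H, IsClosed (W : Set H) → (∀ A ∈ M, ∀ v ∈ W, A v ∈ W) → W = ⊥ ∨ W = ⊤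

/-- The restrictions to `M` of the elements of the predual of `B(H)`, that is the functionals
`A ↦ Tr (ρ A)` with the trace-class operators `ρ = ∑ |χₙ⟩⟨ψₙ|`, `∑ ‖ψₙ‖ ‖χₙ‖ < ∞`. -/
def normalFunctionals (M : StarSubalgebra ℂ (H →L[ℂ] H)) : Submodule ℂ (StrongDual ℂ M) where
  carrier := {φ | ∃ ψ χ : ℕ → H, (Summable fun n => ‖ψ n‖ * ‖χ n‖) ∧
    ∀ A : M, HasSum (fun n => inner ℂ (ψ n) ((A : H →L[ℂ] H) (χ n))) (φ A)}
  zero_mem' := ⟨0, 0, by simp, fun A => by simp⟩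
  add_mem' := by
    rintro φ φ' ⟨ψ, χ, hs, hφ⟩ ⟨ψ', χ', hs', hφ'⟩
    let e := Equiv.natSumNatEquivNat
    refine ⟨fun n => Sum.elim ψ ψ' (e.symm n), fun n => Sum.elim χ χ' (e.symm n), ?_, fun A => ?_⟩
    · refine (e.symm.summable_iff (f := fun i : ℕ ⊕ ℕ =>
        ‖Sum.elim ψ ψ' i‖ * ‖Sum.elim χ χ' i‖)).2 ?_
      exact Summable.sum _ (by simpa [Function.comp_def] using hs)
        (by simpa [Function.comp_def] using hs')
    · refine (e.symm.hasSum_iff (f := fun i : ℕ ⊕ ℕ =>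
        inner ℂ (Sum.elim ψ ψ' i) ((A : H →L[ℂ] H) (Sum.elim χ χ' i)))).2 ?_
      exact HasSum.sum (by simpa [Function.comp_def] using hφ A)
        (by simpa [Function.comp_def] using hφ' A)
  smul_mem' := by
    rintro c φ ⟨ψ, χ, hs, hφ⟩
    refine ⟨ψ, fun n => c • χ n, ?_, fun A => ?_⟩
    · refine (hs.mul_left ‖c‖).congr fun n => ?_
      rw [norm_smul]; ring
    · simpa [inner_smul_right] using (hφ A).mul_left c

/-- The functional `A ↦ (Ω | A Ω)` on `M`. -/
def vectorFunctional (M : StarSubalgebra ℂ (H →L[ℂ] H)) (Ω : H) : StrongDual ℂ M :=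
  LinearMap.mkContinuous
    { toFun := fun A : M => inner ℂ Ω ((A : H →L[ℂ] H) Ω)
      map_add' := fun A B => by simp
      map_smul' := fun c A => by simp }
    (‖Ω‖ * ‖Ω‖) (fun A => by
      calc ‖inner ℂ Ω ((A : H →L[ℂ] H) Ω)‖ ≤ ‖Ω‖ * ‖(A : H →L[ℂ] H) Ω‖ := norm_inner_le_norm _ _
        _ ≤ ‖Ω‖ * (‖(A : H →L[ℂ] H)‖ * ‖Ω‖) := by gcongr; exact (A : H →L[ℂ] H).le_opNorm Ω
        _ = ‖Ω‖ * ‖Ω‖ * ‖A‖ := by rw [show ‖A‖ = ‖(A : H →L[ℂ] H)‖ from rfl]; ring)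

theorem vectorFunctional_mem (M : StarSubalgebra ℂ (H →L[ℂ] H)) (Ω : H) :
    vectorFunctional M Ω ∈ normalFunctionals M := by
  refine ⟨Pi.single 0 Ω, Pi.single 0 Ω, ?_, fun A => ?_⟩
  · refine summable_of_ne_finset_zero (s := {0}) fun n hn => ?_
    have : n ≠ 0 := by simpa using hn
    simp [Pi.single_eq_of_ne this]
  · have h := hasSum_single (f := fun n => inner ℂ ((Pi.single 0 Ω : ℕ → H) n)
      ((A : H →L[ℂ] H) ((Pi.single 0 Ω : ℕ → H) n))) 0 fun n hn => by
        simp [Pi.single_eq_of_ne hn]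
    simpa [vectorFunctional] using h

/-- The joint spectrum of the generators of a strongly continuous unitary representation
`U(x) = ∫ e^{ipx} dE(p)` of the translations, i.e. the support of the spectral measure `E`: the
Fourier transform of `x ↦ (ψ | U(x) χ)` is a multiple of the measure `(ψ | E(·) χ)`. -/
def jointSpectrum {s : ℕ} (U : (Fin (s + 1) → ℝ) → unitary (H →L[ℂ] H)) :
    Set (Fin (s + 1) → ℝ) :=
  closure (⋃ ψ : H, ⋃ χ : H,
    fourierSupport (minkowskiForm s) fun x => inner ℂ ψ ((U x : H →L[ℂ] H) χ))

end Operators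

/-! ### Local nets and quantum field theories -/

/-- A net of unital C*-algebras of operators on `H`, attached to the open bounded regions of
`ℝ^{s+1}`, which satisfies isotony and locality. Only the values of `net` on open bounded sets are
meaningful. -/
structure LocalNet (s : ℕ) (H : Type*) [NormedAddCommGroup H] [InnerProductSpace ℂ H]
    [CompleteSpace H] where
  net : Set (Fin (s + 1) → ℝ) → StarSubalgebra ℂ (H →L[ℂ] H)
  isClosed_net : ∀ O, IsOpen O → Bornology.IsBounded O → IsClosed (net O : Set (H →L[ℂ] H))
  isotony : ∀ O₁ O₂, IsOpen O₁ → Bornology.IsBounded O₁ → IsOpen O₂ → Bornology.IsBounded O₂ →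
    O₁ ⊆ O₂ → net O₁ ≤ net O₂
  locality : ∀ O₁ O₂, IsOpen O₁ → Bornology.IsBounded O₁ → IsOpen O₂ → Bornology.IsBounded O₂ →
    SpacelikeSeparated O₁ O₂ → ∀ A ∈ net O₁, ∀ B ∈ net O₂, A * B = B * A

namespace LocalNet

variable {s : ℕ} {H : Type*} [NormedAddCommGroup H] [InnerProductSpace ℂ H] [CompleteSpace H]

theorem exists_common (N : LocalNet s H) {A B : H →L[ℂ] H}
    (hA : ∃ O, IsOpen O ∧ Bornology.IsBounded O ∧ A ∈ N.net O)
    (hB : ∃ O, IsOpen O ∧ Bornology.IsBounded O ∧ B ∈ N.net O) :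
    ∃ O, IsOpen O ∧ Bornology.IsBounded O ∧ A ∈ N.net O ∧ B ∈ N.net O := by
  obtain ⟨O₁, h₁, b₁, a₁⟩ := hA
  obtain ⟨O₂, h₂, b₂, a₂⟩ := hB
  exact ⟨O₁ ∪ O₂, h₁.union h₂, b₁.union b₂,
    N.isotony _ _ h₁ b₁ (h₁.union h₂) (b₁.union b₂) Set.subset_union_left a₁,
    N.isotony _ _ h₂ b₂ (h₁.union h₂) (b₁.union b₂) Set.subset_union_right a₂⟩

/-- The `*`-algebra of local operators: the union of all local algebras. -/
def localOperators (N : LocalNet s H) : StarSubalgebra ℂ (H →L[ℂ] H) where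
  carrier := {A | ∃ O, IsOpen O ∧ Bornology.IsBounded O ∧ A ∈ N.net O}
  mul_mem' hA hB := by
    obtain ⟨O, h, b, a, a'⟩ := N.exists_common hA hB
    exact ⟨O, h, b, mul_mem a a'⟩
  add_mem' hA hB := by
    obtain ⟨O, h, b, a, a'⟩ := N.exists_common hA hB
    exact ⟨O, h, b, add_mem a a'⟩
  algebraMap_mem' c := ⟨∅, isOpen_empty, Bornology.isBounded_empty, algebraMap_mem _ c⟩
  star_mem' := by
    rintro A ⟨O, h, b, a⟩
    exact ⟨O, h, b, star_mem a⟩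

/-- The algebra of observables: the norm closure of the local operators. -/
def observables (N : LocalNet s H) : StarSubalgebra ℂ (H →L[ℂ] H) :=
  N.localOperators.topologicalClosure

end LocalNet

/-- A local relativistic quantum field theory on `ℝ^{s+1}`. -/
structure QuantumFieldTheory (s : ℕ) (H : Type*) [NormedAddCommGroup H] [InnerProductSpace ℂ H]
    [CompleteSpace H] extends LocalNet s H where
  infinite_dimensional : ¬ FiniteDimensional ℂ H
  irreducible : ActsIrreducibly toLocalNet.observables
  U : (Fin (s + 1) → ℝ) → unitary (H →L[ℂ] H)
  U_add : ∀ x y, U (x + y) = U x * U y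
  U_continuous : ∀ v : H, Continuous fun x => (U x : H →L[ℂ] H) v
  spectrum_condition : jointSpectrum U ⊆ closedForwardCone s
  /-- `U(x) 𝔄(O) U(x)* = 𝔄(O + x)`. -/
  covariance : ∀ x O, IsOpen O → Bornology.IsBounded O →
    (fun A => (U x : H →L[ℂ] H) * A * star (U x : H →L[ℂ] H)) '' (net O : Set (H →L[ℂ] H)) =
      (net ((fun y => y + x) '' O) : Set (H →L[ℂ] H))
  translations_continuous : ∀ A ∈ toLocalNet.observables,
    Continuous fun x => (U x : H →L[ℂ] H) * A * star (U x : H →L[ℂ] H)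

namespace QuantumFieldTheory

variable {s : ℕ} {H : Type*} [NormedAddCommGroup H] [InnerProductSpace ℂ H] [CompleteSpace H]

/-- The algebra of observables `𝔄`. -/
abbrev algebra (Q : QuantumFieldTheory s H) : StarSubalgebra ℂ (H →L[ℂ] H) :=
  Q.toLocalNet.observables

/-- The space `𝔄_* = B(H)_*`, as a subspace of the dual of `𝔄`. -/
abbrev predual (Q : QuantumFieldTheory s H) : Submodule ℂ (StrongDual ℂ Q.algebra) :=
  normalFunctionals Q.algebra

theorem conj_mem (Q : QuantumFieldTheory s H) (x : Fin (s + 1) → ℝ) {A : H →L[ℂ] H}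
    (hA : A ∈ Q.algebra) :
    (Q.U x : H →L[ℂ] H) * A * star (Q.U x : H →L[ℂ] H) ∈ Q.algebra := by
  have hc : Continuous fun A : H →L[ℂ] H =>
      (Q.U x : H →L[ℂ] H) * A * star (Q.U x : H →L[ℂ] H) := by fun_prop
  refine map_mem_closure (f := fun A : H →L[ℂ] H =>
    (Q.U x : H →L[ℂ] H) * A * star (Q.U x : H →L[ℂ] H)) hc hA ?_
  rintro B ⟨O, h, b, a⟩
  refine ⟨(fun y => y + x) '' O, (Homeomorph.addRight x).isOpenMap O h, ?_, ?_⟩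
  · exact (isometry_add_right x).lipschitz.isBounded_image b
  · have hm : (Q.U x : H →L[ℂ] H) * B * star (Q.U x : H →L[ℂ] H) ∈
        (fun A => (Q.U x : H →L[ℂ] H) * A * star (Q.U x : H →L[ℂ] H)) ''
          (Q.net O : Set (H →L[ℂ] H)) := ⟨B, a, rfl⟩
    rwa [Q.covariance x O h b] at hm

/-- The translation automorphism `α_x(A) = U(x) A U(x)*` of `𝔄`. -/
def translation (Q : QuantumFieldTheory s H) (x : Fin (s + 1) → ℝ) :
    Q.algebra →ₗᵢ[ℂ] Q.algebra where
  toFun A := ⟨(Q.U x : H →L[ℂ] H) * (A : H →L[ℂ] H) * star (Q.U x : H →L[ℂ] H), Q.conj_mem x A.2⟩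
  map_add' A B := by
    ext1
    simp [mul_add, add_mul]
  map_smul' c A := by
    ext1
    simp
  norm_map' A := by
    change ‖(Q.U x : H →L[ℂ] H) * (A : H →L[ℂ] H) * star (Q.U x : H →L[ℂ] H)‖ =
      ‖(A : H →L[ℂ] H)‖
    rw [CStarRing.norm_mul_mem_unitary _ (Unitary.star_mem (Q.U x).2),
      CStarRing.norm_coe_unitary_mul]

theorem translation_zero (Q : QuantumFieldTheory s H) (A : Q.algebra) :
    Q.translation 0 A = A := by
  have h : Q.U 0 = 1 := by
    have := Q.U_add 0 0
    rw [add_zero] at this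
    exact left_eq_mul.1 this
  ext1
  simp [translation, h]

theorem translation_add (Q : QuantumFieldTheory s H) (x y : Fin (s + 1) → ℝ) (A : Q.algebra) :
    Q.translation (x + y) A = Q.translation x (Q.translation y A) := by
  ext1
  simp [translation, Q.U_add, mul_assoc]

theorem translation_continuous (Q : QuantumFieldTheory s H) (A : Q.algebra) :
    Continuous fun x => Q.translation x A :=
  (Q.translations_continuous A A.2).subtype_mk _

theorem predual_invariant (Q : QuantumFieldTheory s H) (x : Fin (s + 1) → ℝ) :
    ∀ φ ∈ Q.predual, φ.comp (Q.translation x).toContinuousLinearMap ∈ Q.predual := by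
  rintro φ ⟨ψ, χ, hs, hφ⟩
  refine ⟨fun n => star (Q.U x : H →L[ℂ] H) (ψ n), fun n => star (Q.U x : H →L[ℂ] H) (χ n),
    ?_, fun A => ?_⟩
  · have h : ∀ v, ‖star (Q.U x : H →L[ℂ] H) v‖ = ‖v‖ := fun v => by
      simpa using ContinuousLinearMap.norm_map_of_mem_unitary (Unitary.star_mem (Q.U x).2) v
    simpa [h] using hs
  · have e : ∀ n, inner ℂ (star (Q.U x : H →L[ℂ] H) (ψ n))
        ((A : H →L[ℂ] H) (star (Q.U x : H →L[ℂ] H) (χ n))) =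
        inner ℂ (ψ n) ((Q.translation x A : H →L[ℂ] H) (χ n)) := fun n => by
      rw [ContinuousLinearMap.star_eq_adjoint, ContinuousLinearMap.adjoint_inner_left]
      rfl
    simp only [e]
    exact hφ (Q.translation x A)

/-- The group `α` of spacetime translation automorphisms of `𝔄`, with `𝔄_* = B(H)_*`. -/
def spacetimeTranslations (Q : QuantumFieldTheory s H) :
    IsometryGroup (s + 1) Q.algebra Q.predual :=
  IsometryGroup.ofDualSubspace Q.translation Q.translation_zero Q.translation_add
    Q.translation_continuous Q.predual

/-- The transposed action `α*` on `𝔄_*`. -/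
def dualSpacetimeTranslations (Q : QuantumFieldTheory s H) :
    IsometryGroup (s + 1) Q.predual Q.algebra :=
  IsometryGroup.transpose Q.translation Q.translation_zero Q.translation_add
    Q.translation_continuous Q.predual Q.predual_invariant

/-- The group `β_x = α_{(0, x)}` of space translation automorphisms. -/
def spaceTranslations (Q : QuantumFieldTheory s H) : IsometryGroup s Q.algebra Q.predual :=
  Q.spacetimeTranslations.restrict (spaceEmbedding s)

/-- The transposed action `β*` on `𝔄_*`. -/
def dualSpaceTranslations (Q : QuantumFieldTheory s H) : IsometryGroup s Q.predual Q.algebra :=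
  Q.dualSpacetimeTranslations.restrict (spaceEmbedding s)

/-- A vacuum vector: a unit vector which is invariant under the translations. -/
def IsVacuumVector (Q : QuantumFieldTheory s H) (Ω : H) : Prop :=
  ‖Ω‖ = 1 ∧ ∀ x, (Q.U x : H →L[ℂ] H) Ω = Ω

/-- The functional `ω₀ = (Ω | · Ω)` as an element of `𝔄_*`. -/
def vacuumState (Q : QuantumFieldTheory s H) (Ω : H) : Q.predual :=
  ⟨vectorFunctional Q.algebra Ω, vectorFunctional_mem Q.algebra Ω⟩

/-- The kernel of `ω₀` in `𝔄`. -/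
def kerVacuum (Q : QuantumFieldTheory s H) (Ω : H) : Submodule ℂ Q.algebra :=
  LinearMap.ker ((Q.vacuumState Ω : StrongDual ℂ Q.algebra) : Q.algebra →ₗ[ℂ] ℂ)

/-- The kernel of the unit `I` in `𝔄_*`, i.e. the functionals which vanish on `I`. -/
def kerUnit (Q : QuantumFieldTheory s H) : Submodule ℂ Q.predual :=
  LinearMap.ker (((ContinuousLinearMap.coeLM ℂ).comp Q.predual.subtype).flip (1 : Q.algebra))

end QuantumFieldTheory

end

/-! Let `ω₀(A) = 0`. The averages over `K_L` of `e^{-iqx} α_x(A)` are bounded by `‖A‖`, so they have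
weak limits along every ultrafilter finer than `L → ∞`. Since `K_L` has time extension `L^ε` with `ε
< 1` but space extension `L`, all but a vanishing fraction of its points move a given bounded region
spacelike to another one. By locality, and by norm approximation of `A`, the commutators with a
local operator average to zero in norm (`tendsto_integral_commutatorNorm`). A weak limit therefore
commutes with all local operators, and by irreducibility it is a scalar
(`ActsIrreducibly.exists_eq_smul`). The vacuum determines this scalar: `(Ω|α_x(A)Ω) = ω₀(A) = 0` for
all `x`, so it vanishes whatever `q` is (`tendsto_integral_inner`). Dominated convergence extends
this from matrix elements to normal functionals, which gives `ker ω₀ ⊂ 𝔄_c`.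

The rest uses only an invariant vector `e` and an invariant functional `η` with `η(e) = 1` and `ker
η` inside the continuous subspace. An element whose spectrum is one point `q` has multiples of the
character `e^{iqx}` as its coefficients, because a bounded function whose Fourier transform sits at
a point is a multiple of a character (`eq_exp_mul_of_fourierSupport_subset`). Then `A - η(A)e` has
constant twisted coefficients whose means tend to zero, so `A = η(A)e`. This argument applies to
`(I, ω₀)` on `𝔄` and to `(ω₀, I)` on `𝔄_*`. The two continuous spectra agree because they are built
from the same functions `x ↦ φ(α_x(A))`: a functional that kills `I` does not see the component of
`A` along `I`, and an `A` in `ker ω₀` does not see the component of `φ` along `ω₀`. -/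

noncomputable section

/-! ### The Fourier transform with respect to a bilinear form -/

section FormFourier

variable {d : ℕ} {B : LinearMap.BilinForm ℝ (Fin d → ℝ)} {g : (Fin d → ℝ) → ℂ}

/-- The Fourier transform `∫ dp e^{-ipx} g(p)` of a test function, where `px` is `B p x`. -/
def formFourier (B : LinearMap.BilinForm ℝ (Fin d → ℝ)) (g : (Fin d → ℝ) → ℂ)
    (x : Fin d → ℝ) : ℂ :=
  ∫ p : Fin d → ℝ, Complex.exp (-Complex.I * (B p x : ℝ)) * g p

theorem fourierPairing_eq (B : LinearMap.BilinForm ℝ (Fin d → ℝ)) (F g : (Fin d → ℝ) → ℂ) :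
    fourierPairing B F g =
      (((2 * Real.pi) ^ (-(d : ℝ) / 2) : ℝ) : ℂ) * ∫ x, F x * formFourier B g x :=
  rfl

theorem fourierPairing_eq_zero_iff (B : LinearMap.BilinForm ℝ (Fin d → ℝ))
    (F g : (Fin d → ℝ) → ℂ) :
    fourierPairing B F g = 0 ↔ ∫ x, F x * formFourier B g x = 0 := by
  rw [fourierPairing_eq, mul_eq_zero, or_iff_right]
  exact_mod_cast (Real.rpow_pos_of_pos (by positivity) _).ne'

/-- Nondegeneracy makes `x ↦ (2π)⁻¹ B(·, x)` a linear isomorphism; the factor matches the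
`e^{-2πi⟨v,w⟩}` convention. This opens the Schwartz theory, which needs the inner product of
`EuclideanSpace`. -/
theorem exists_formFourier_eq_fourier (hB : ∀ x, (∀ p, B p x = 0) → x = 0) :
    ∃ S : (Fin d → ℝ) ≃L[ℝ] EuclideanSpace ℝ (Fin d), ∀ g x, formFourier B g x =
      FourierTransform.fourier (fun v : EuclideanSpace ℝ (Fin d) => g v.ofLp) (S x) := by
  let M : (Fin d → ℝ) →ₗ[ℝ] (Fin d → ℝ) :=
    LinearMap.pi fun i => (2 * Real.pi)⁻¹ • B (Pi.single i 1)
  have key : ∀ p x, ∑ i, p i * M x i = (2 * Real.pi)⁻¹ * B p x := fun p x => by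
    have hp : p = ∑ i, p i • (Pi.single i 1 : Fin d → ℝ) := by
      simpa using (pi_eq_sum_univ' p)
    conv_rhs => rw [hp]
    simp only [map_sum, map_smul, LinearMap.sum_apply, LinearMap.smul_apply, smul_eq_mul,
      Finset.mul_sum, M, LinearMap.pi_apply]
    exact Finset.sum_congr rfl fun i _ => by ring
  have hM : Function.Injective M := by
    rw [← LinearMap.ker_eq_bot, LinearMap.ker_eq_bot']
    intro x hx
    refine hB x fun p => ?_
    have h := key p x
    have : (2 * Real.pi)⁻¹ ≠ 0 := by positivity
    simp only [hx, Pi.zero_apply, mul_zero, Finset.sum_const_zero] at h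
    exact (mul_eq_zero.1 h.symm).resolve_left this
  refine ⟨(LinearEquiv.ofInjectiveEndo M hM).toContinuousLinearEquiv.trans
    (EuclideanSpace.equiv (Fin d) ℝ).symm, fun g x => ?_⟩
  rw [Real.fourier_eq', formFourier, ← (PiLp.volume_preserving_ofLp (Fin d)).integral_comp
    (MeasurableEquiv.toLp 2 (Fin d → ℝ)).symm.measurableEmbedding]
  refine integral_congr_ae (Eventually.of_forall fun v => ?_)
  have h := key v.ofLp x
  have e : inner ℝ v ((EuclideanSpace.equiv (Fin d) ℝ).symm (M x)) = ∑ i, v i * M x i := by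
    simp [PiLp.inner_apply, mul_comm]
  have h2 : -Complex.I * ((B v.ofLp x : ℝ) : ℂ) =
      ((-2 * Real.pi * ((2 * Real.pi)⁻¹ * B v.ofLp x) : ℝ) : ℂ) * Complex.I := by
    have h3 : (-2 * Real.pi * ((2 * Real.pi)⁻¹ * B v.ofLp x)) = - B v.ofLp x := by
      field_simp
    rw [h3]
    push_cast
    ring
  change Complex.exp (-Complex.I * ((B v.ofLp x : ℝ) : ℂ)) * g v.ofLp =
    Complex.exp (((-2 * Real.pi * inner ℝ v
      ((EuclideanSpace.equiv (Fin d) ℝ).symm (M x)) : ℝ) : ℂ) * Complex.I) • g v.ofLp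
  rw [e, h, smul_eq_mul, h2]

/-- Uniqueness of Haar measure; only the nonvanishing of the Jacobian factor matters later. -/
theorem exists_integral_comp_eq (S : (Fin d → ℝ) ≃L[ℝ] EuclideanSpace ℝ (Fin d)) :
    ∃ K : ℝ, K ≠ 0 ∧ ∀ f : EuclideanSpace ℝ (Fin d) → ℂ, ∫ x, f (S x) = K * ∫ v, f v := by
  have hh : (Measure.map S (volume : Measure (Fin d → ℝ))).IsAddHaarMeasure :=
    S.isAddHaarMeasure_map _
  let μ : Measure (EuclideanSpace ℝ (Fin d)) := Measure.map S volume
  refine ⟨Measure.addHaarScalarFactor μ volume, ?_, fun f => ?_⟩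
  · exact_mod_cast (Measure.addHaarScalarFactor_pos_of_isAddHaarMeasure μ volume).ne'
  · have h := S.toHomeomorph.measurableEmbedding.integral_map (μ := volume) f
    have h' : μ = Measure.addHaarScalarFactor μ volume • volume :=
      Measure.isAddLeftInvariant_eq_smul _ _
    change ∫ y, f y ∂μ = _ at h
    rw [h', integral_smul_nnreal_measure] at h
    change _ = ∫ x, f (S x) at h
    rw [← h, NNReal.smul_def, Complex.real_smul]

theorem exists_schwartzMap (hg : ContDiff ℝ ∞ g) (hg' : HasCompactSupport g) :
    ∃ f : SchwartzMap (EuclideanSpace ℝ (Fin d)) ℂ, ∀ v, f v = g v.ofLp :=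
  ⟨HasCompactSupport.toSchwartzMap (f := g ∘ EuclideanSpace.equiv (Fin d) ℝ)
    (hg'.comp_homeomorph (EuclideanSpace.equiv (Fin d) ℝ).toHomeomorph)
    (hg.comp (EuclideanSpace.equiv (Fin d) ℝ).contDiff), fun _ => rfl⟩

theorem continuous_formFourier (hB : ∀ x, (∀ p, B p x = 0) → x = 0) (hg : ContDiff ℝ ∞ g)
    (hg' : HasCompactSupport g) : Continuous (formFourier B g) := by
  obtain ⟨S, hS⟩ := exists_formFourier_eq_fourier hB
  obtain ⟨f, hf⟩ := exists_schwartzMap hg hg'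
  have h : formFourier B g = FourierTransform.fourier f ∘ S := by
    funext x
    rw [hS, ← funext hf, ← SchwartzMap.fourier_coe]
    rfl
  rw [h]
  exact (SchwartzMap.continuous _).comp S.continuous

/-- Schwartz decay carried back through the linear isomorphism. The order `d + 1` is the first
integer order integrable on `ℝ^d`. -/
theorem exists_norm_formFourier_le (hB : ∀ x, (∀ p, B p x = 0) → x = 0) (hg : ContDiff ℝ ∞ g)
    (hg' : HasCompactSupport g) :
    ∃ C, 0 ≤ C ∧ ∀ x, ‖formFourier B g x‖ ≤ C * (1 + ‖x‖) ^ (-(d + 1 : ℝ)) := by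
  obtain ⟨S, hS⟩ := exists_formFourier_eq_fourier hB
  obtain ⟨f, hf⟩ := exists_schwartzMap hg hg'
  have h : ∀ x, formFourier B g x = FourierTransform.fourier f (S x) := fun x => by
    rw [hS, ← funext hf, ← SchwartzMap.fourier_coe]
  let C₀ := 2 ^ (d + 1) * ((Finset.Iic (d + 1, 0)).sup fun m : ℕ × ℕ =>
    SchwartzMap.seminorm ℂ (E := EuclideanSpace ℝ (Fin d)) (F := ℂ) m.1 m.2)
      (FourierTransform.fourier f)
  have hC₀ : ∀ v, (1 + ‖v‖) ^ (d + 1) * ‖FourierTransform.fourier f v‖ ≤ C₀ := fun v => by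
    simpa using SchwartzMap.one_add_le_sup_seminorm_apply (𝕜 := ℂ) (m := (d + 1, 0)) (k := d + 1)
      (n := 0) le_rfl le_rfl (FourierTransform.fourier f) v
  have h0 : 0 ≤ C₀ := le_trans (by positivity) (hC₀ 0)
  let c := 1 + ‖(S.symm : EuclideanSpace ℝ (Fin d) →L[ℝ] (Fin d → ℝ))‖
  have hc : ∀ x, 1 + ‖x‖ ≤ c * (1 + ‖S x‖) := fun x => by
    have := (S.symm : EuclideanSpace ℝ (Fin d) →L[ℝ] (Fin d → ℝ)).le_opNorm (S x)
    simp only [ContinuousLinearEquiv.coe_coe, ContinuousLinearEquiv.symm_apply_apply] at this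
    have h1 := norm_nonneg (S.symm : EuclideanSpace ℝ (Fin d) →L[ℝ] (Fin d → ℝ))
    have h2 := norm_nonneg (S x)
    simp only [c]
    nlinarith
  have hc0 : 0 ≤ c := by positivity
  refine ⟨c ^ (d + 1) * C₀, by positivity, fun x => ?_⟩
  have e : (1 + ‖x‖) ^ (-(d + 1 : ℝ)) = ((1 + ‖x‖) ^ (d + 1))⁻¹ := by
    rw [Real.rpow_neg (by positivity)]
    exact_mod_cast rfl
  rw [e, h, ← div_eq_mul_inv, le_div_iff₀ (by positivity)]
  calc ‖FourierTransform.fourier f (S x)‖ * (1 + ‖x‖) ^ (d + 1)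
      ≤ ‖FourierTransform.fourier f (S x)‖ * (c * (1 + ‖S x‖)) ^ (d + 1) := by
        gcongr; exact hc x
    _ = c ^ (d + 1) * ((1 + ‖S x‖) ^ (d + 1) * ‖FourierTransform.fourier f (S x)‖) := by
        rw [mul_pow]; ring
    _ ≤ c ^ (d + 1) * C₀ := by gcongr; exact hC₀ _

theorem integrable_one_add_norm_pi (d : ℕ) :
    Integrable fun x : Fin d → ℝ => (1 + ‖x‖) ^ (-(d + 1 : ℝ)) :=
  integrable_one_add_norm (by simp)

theorem integrable_formFourier (hB : ∀ x, (∀ p, B p x = 0) → x = 0) (hg : ContDiff ℝ ∞ g)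
    (hg' : HasCompactSupport g) : Integrable (formFourier B g) := by
  obtain ⟨C, -, hC⟩ := exists_norm_formFourier_le hB hg hg'
  exact ((integrable_one_add_norm_pi d).const_mul C).mono'
    (continuous_formFourier hB hg hg').aestronglyMeasurable (Eventually.of_forall hC)

theorem integrable_mul_formFourier (hB : ∀ x, (∀ p, B p x = 0) → x = 0) (hg : ContDiff ℝ ∞ g)
    (hg' : HasCompactSupport g) {F : (Fin d → ℝ) → ℂ} (hF : Continuous F) {C : ℝ}
    (hC : ∀ x, ‖F x‖ ≤ C) : Integrable fun x => F x * formFourier B g x :=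
  (integrable_formFourier hB hg hg').bdd_mul hF.aestronglyMeasurable (Eventually.of_forall hC)

/-- Fourier inversion at the origin. -/
theorem exists_integral_formFourier (hB : ∀ x, (∀ p, B p x = 0) → x = 0) :
    ∃ K : ℂ, K ≠ 0 ∧ ∀ g : (Fin d → ℝ) → ℂ, ContDiff ℝ ∞ g → HasCompactSupport g →
      ∫ x, formFourier B g x = K * g 0 := by
  obtain ⟨S, hS⟩ := exists_formFourier_eq_fourier hB
  obtain ⟨K, hK, hKf⟩ := exists_integral_comp_eq S
  refine ⟨K, by exact_mod_cast hK, fun g hg hg' => ?_⟩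
  obtain ⟨f, hf⟩ := exists_schwartzMap hg hg'
  have h : ∀ x, formFourier B g x = FourierTransform.fourier f (S x) := fun x => by
    rw [hS, ← funext hf, ← SchwartzMap.fourier_coe]
  -- At the origin the exponential in the inversion formula is `1`, which leaves the plain integral
  -- of the transform.
  have h2 := congrArg (fun u : SchwartzMap (EuclideanSpace ℝ (Fin d)) ℂ => u 0)
    (FourierTransform.fourierInv_fourier_eq (F := SchwartzMap (EuclideanSpace ℝ (Fin d)) ℂ) f)
  simp only [SchwartzMap.fourierInv_coe, Real.fourierInv_eq', inner_zero_right, mul_zero,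
    Complex.ofReal_zero, zero_mul, Complex.exp_zero, one_smul, hf] at h2
  simp only [h, hKf, h2]
  rfl

theorem integrable_exp_mul (B : LinearMap.BilinForm ℝ (Fin d → ℝ)) (hg : Continuous g)
    (hg' : HasCompactSupport g) (x : Fin d → ℝ) :
    Integrable fun p => Complex.exp (-Complex.I * (B p x : ℝ)) * g p := by
  have hc : Continuous fun p => B p x := (B.flip x).continuous_of_finiteDimensional
  exact Continuous.integrable_of_hasCompactSupport (by fun_prop) hg'.mul_left

theorem formFourier_sub {g₁ g₂ : (Fin d → ℝ) → ℂ} (h₁ : Continuous g₁)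
    (h₁' : HasCompactSupport g₁) (h₂ : Continuous g₂) (h₂' : HasCompactSupport g₂)
    (x : Fin d → ℝ) :
    formFourier B (fun p => g₁ p - g₂ p) x = formFourier B g₁ x - formFourier B g₂ x := by
  simp only [formFourier, mul_sub]
  exact integral_sub (integrable_exp_mul B h₁ h₁' x) (integrable_exp_mul B h₂ h₂' x)

theorem formFourier_sum {ι : Type*} [Fintype ι] {g : ι → (Fin d → ℝ) → ℂ}
    (h : ∀ i, Continuous (g i)) (h' : ∀ i, HasCompactSupport (g i)) (x : Fin d → ℝ) :
    formFourier B (fun p => ∑ i, g i p) x = ∑ i, formFourier B (g i) x := by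
  simp only [formFourier, Finset.mul_sum]
  exact integral_finsetSum _ fun i _ => integrable_exp_mul B (h i) (h' i) x

theorem formFourier_exp_mul (y x : Fin d → ℝ) :
    formFourier B (fun p => Complex.exp (Complex.I * (B p y : ℝ)) * g p) x =
      formFourier B g (x - y) := by
  simp only [formFourier]
  refine integral_congr_ae (Eventually.of_forall fun p => ?_)
  simp only [map_sub, Complex.ofReal_sub, ← mul_assoc, ← Complex.exp_add]
  congr 2
  ring

theorem formFourier_comp_sub (q x : Fin d → ℝ) :
    formFourier B (fun p => g (p - q)) x =
      Complex.exp (-Complex.I * (B q x : ℝ)) * formFourier B g x := by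
  simp only [formFourier]
  rw [← integral_const_mul, ← integral_add_right_eq_self _ q]
  refine integral_congr_ae (Eventually.of_forall fun p => ?_)
  simp only [map_add, LinearMap.add_apply, Complex.ofReal_add, ← mul_assoc, ← Complex.exp_add,
    add_sub_cancel_right]
  congr 2
  ring

theorem formFourier_comp_smul {t : ℝ} (ht : 0 < t) (x : Fin d → ℝ) :
    formFourier B (fun p => g (t • p)) x = ((t⁻¹ ^ d : ℝ) : ℂ) * formFourier B g (t⁻¹ • x) := by
  have h := Measure.integral_comp_smul (volume : Measure (Fin d → ℝ))
    (fun p => Complex.exp (-Complex.I * (B p (t⁻¹ • x) : ℝ)) * g p) t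
  simp only [formFourier]
  rw [Complex.real_smul, Module.finrank_fin_fun, abs_of_pos (by positivity), ← inv_pow] at h
  rw [← h]
  refine integral_congr_ae (Eventually.of_forall fun p => ?_)
  have e : B (t • p) (t⁻¹ • x) = B p x := by
    simp [ht.ne']
  simp only [e]

/-- The factor `t⁻ᵈ` of the dilated transform cancels the Jacobian of `x ↦ t • x`, so dilating the
test function amounts to dilating `F`. -/
theorem integral_mul_formFourier_comp_smul {t : ℝ} (ht : 0 < t) (F : (Fin d → ℝ) → ℂ) :
    ∫ x, F x * formFourier B (fun p => g (t • p)) x = ∫ x, F (t • x) * formFourier B g x := by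
  have h := Measure.integral_comp_smul (volume : Measure (Fin d → ℝ))
    (fun x => F (t • x) * formFourier B g x) t⁻¹
  rw [Complex.real_smul, Module.finrank_fin_fun, abs_of_pos (by positivity), inv_pow, inv_inv]
    at h
  simp only [formFourier_comp_smul ht, mul_left_comm (F _)]
  rw [integral_const_mul]
  simp only [smul_smul, mul_inv_cancel₀ ht.ne', one_smul] at h
  rw [h, ← mul_assoc, ← Complex.ofReal_mul, ← mul_pow, inv_mul_cancel₀ ht.ne', one_pow,
    Complex.ofReal_one, one_mul]

end FormFourier

/-! ### Functions whose Fourier transform is supported in a point -/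

section PointSupport

variable {d : ℕ} {B : LinearMap.BilinForm ℝ (Fin d → ℝ)} {F : (Fin d → ℝ) → ℂ}

open scoped Manifold in
/-- A distribution vanishes on the test functions supported off its support. -/
theorem integral_mul_formFourier_eq_zero (hB : ∀ x, (∀ p, B p x = 0) → x = 0)
    (hF : Continuous F) {C : ℝ} (hC : ∀ x, ‖F x‖ ≤ C) {g : (Fin d → ℝ) → ℂ}
    (hg : ContDiff ℝ ∞ g) (hg' : HasCompactSupport g)
    (hd : Disjoint (tsupport g) (fourierSupport B F)) :
    ∫ x, F x * formFourier B g x = 0 := by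
  -- The support is defined pointwise, so vanishing is known only on small neighbourhoods;
  -- compactness and a smooth partition of unity patch these together.
  have hloc : ∀ p ∈ tsupport g, ∃ V : Set (Fin d → ℝ), IsOpen V ∧ p ∈ V ∧
      ∀ f : (Fin d → ℝ) → ℂ, ContDiff ℝ ∞ f → HasCompactSupport f → tsupport f ⊆ V →
        ∫ x, F x * formFourier B f x = 0 := by
    intro p hp
    have h := Set.disjoint_left.1 hd hp
    simp only [fourierSupport, Set.mem_ofPred_eq] at h
    push Not at h
    obtain ⟨V, hV, hpV, hf⟩ := h
    exact ⟨V, hV, hpV, fun f h₁ h₂ h₃ =>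
      (fourierPairing_eq_zero_iff B F f).1 (hf f h₁ h₂ h₃)⟩
  choose! V hVo hVm hV using hloc
  have hK : IsCompact (tsupport g) := hg'
  obtain ⟨t, ht, hcov⟩ := hK.elim_nhds_subcover V fun p hp => (hVo p hp).mem_nhds (hVm p hp)
  obtain ⟨ρ, hρ⟩ := SmoothPartitionOfUnity.exists_isSubordinate 𝓘(ℝ, Fin d → ℝ) hK.isClosed
    (fun i : t => V i) (fun i => hVo i (ht i i.2)) (by simpa [Set.iUnion_subtype] using hcov)
  have hs : ∀ i : t, ContDiff ℝ ∞ fun p => (ρ i p : ℂ) * g p := fun i =>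
    (Complex.ofRealCLM.contDiff.comp (ρ i).contMDiff.contDiff).mul hg
  have hs' : ∀ i : t, HasCompactSupport fun p => (ρ i p : ℂ) * g p := fun i => hg'.mul_left
  have hsum : g = fun p => ∑ i : t, (ρ i p : ℂ) * g p := by
    funext p
    by_cases hp : p ∈ tsupport g
    · have h1 := ρ.sum_eq_one hp
      rw [finsum_eq_sum_of_fintype] at h1
      rw [← Finset.sum_mul, ← Complex.ofReal_sum, h1, Complex.ofReal_one, one_mul]
    · simp [image_eq_zero_of_notMem_tsupport hp]
  rw [hsum]
  simp only [formFourier_sum (fun i => (hs i).continuous) hs', Finset.mul_sum]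
  rw [integral_finsetSum _ fun i _ => integrable_mul_formFourier hB (hs i) (hs' i) hF hC]
  refine Finset.sum_eq_zero fun i _ => hV i (ht i i.2) _ (hs i) (hs' i) ?_
  refine Set.Subset.trans (closure_mono ?_) (hρ i)
  intro p hp h0
  exact hp (by simp only [h0, Complex.ofReal_zero, zero_mul])

/-- Provides one integrable majorant for all shifts of length at most `1`, as dominated convergence
requires. -/
theorem rpow_one_add_norm_sub_le (u y : Fin d → ℝ) (hy : ‖y‖ ≤ 1) :
    (1 + ‖u - y‖) ^ (-(d + 1 : ℝ)) ≤ 2 ^ (d + 1 : ℝ) * (1 + ‖u‖) ^ (-(d + 1 : ℝ)) := by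
  have h : (1 + ‖u‖) / 2 ≤ 1 + ‖u - y‖ := by
    have := norm_sub_norm_le u y
    have := norm_nonneg (u - y)
    linarith
  calc (1 + ‖u - y‖) ^ (-(d + 1 : ℝ)) ≤ ((1 + ‖u‖) / 2) ^ (-(d + 1 : ℝ)) :=
        Real.rpow_le_rpow_of_nonpos (by positivity) h
          (by have : (0 : ℝ) ≤ d := d.cast_nonneg
              linarith)
    _ = _ := by
        rw [Real.div_rpow (by positivity) (by norm_num), Real.rpow_neg (x := 2) (by norm_num),
          div_inv_eq_mul, mul_comm]

/-- A bounded function whose Fourier transform is supported at the origin is constant. -/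
theorem eq_apply_zero_of_formFourier (hB : ∀ x, (∀ p, B p x = 0) → x = 0)
    (hF : Continuous F) {C : ℝ} (hC : ∀ x, ‖F x‖ ≤ C)
    (hF₀ : ∀ g : (Fin d → ℝ) → ℂ, ContDiff ℝ ∞ g → HasCompactSupport g → 0 ∉ tsupport g →
      ∫ x, F x * formFourier B g x = 0) (x : Fin d → ℝ) : F x = F 0 := by
  let b : ContDiffBump (0 : Fin d → ℝ) := ⟨1, 2, one_pos, one_lt_two⟩
  let ψ : (Fin d → ℝ) → ℂ := fun p => (b p : ℂ)
  have hψ : ContDiff ℝ ∞ ψ := Complex.ofRealCLM.contDiff.comp b.contDiff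
  have hψ' : HasCompactSupport ψ := b.hasCompactSupport.comp_left Complex.ofReal_zero
  have hψ₁ : ψ =ᶠ[𝓝 0] fun _ => 1 := by
    filter_upwards [b.eventuallyEq_one] with p hp
    simp [ψ, hp]
  have hψt : ∀ t : ℝ, ContDiff ℝ ∞ fun p => ψ (t • p) := fun t =>
    hψ.comp (contDiff_const_smul t)
  have hψt' : ∀ t : ℝ, 0 < t → HasCompactSupport fun p => ψ (t • p) := fun t ht =>
    hψ'.comp_smul ht.ne'
  have hψt₁ : ∀ t : ℝ, (fun p => ψ (t • p)) =ᶠ[𝓝 0] fun _ => 1 := fun t => by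
    have : Tendsto (fun p : Fin d → ℝ => t • p) (𝓝 0) (𝓝 0) := by
      have := (continuous_const_smul t).tendsto (0 : Fin d → ℝ)
      rwa [smul_zero] at this
    exact this.eventually hψ₁
  let h := formFourier B ψ
  have hh : Continuous h := continuous_formFourier hB hψ hψ'
  have hhi : Integrable h := integrable_formFourier hB hψ hψ'
  -- `N t y` is a smeared value of `F` around `y` at scale `t`. It will turn out not to depend on
  -- `t`; comparing `t → 0` with `t → ∞` replaces the structure theorem for distributions supported
  -- at a point.
  let N : ℝ → (Fin d → ℝ) → ℂ := fun t y => ∫ u, F (t • u + y) * h u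
  have hN : ∀ t, 0 < t → ∀ y, N t y = ∫ u, F u * formFourier B
      (fun p => Complex.exp (Complex.I * (B p y : ℝ)) * ψ (t • p)) u := by
    intro t ht y
    simp only [formFourier_exp_mul (g := fun p => ψ (t • p))]
    have h1 := integral_sub_right_eq_self (μ := (volume : Measure (Fin d → ℝ)))
      (fun u => F (u + y) * formFourier B (fun p => ψ (t • p)) u) y
    simp only [sub_add_cancel] at h1
    rw [h1]
    exact (integral_mul_formFourier_comp_smul ht fun u => F (u + y)).symm
  have hexp : ∀ y, ContDiff ℝ ∞ fun p => Complex.exp (Complex.I * (B p y : ℝ)) := fun y => by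
    have h1 : ContDiff ℝ ∞ fun p => B p y :=
      (LinearMap.toContinuousLinearMap (B.flip y)).contDiff
    exact (contDiff_const.mul (Complex.ofRealCLM.contDiff.comp h1)).cexp
  -- Both cutoffs equal `1` near the origin, so the difference of the two test functions vanishes
  -- there and `hF₀` applies.
  have hNN : ∀ t t', 0 < t → 0 < t' → ∀ y, N t y = N t' y := by
    intro t t' ht ht' y
    have c : ∀ t : ℝ, ContDiff ℝ ∞ fun p => Complex.exp (Complex.I * (B p y : ℝ)) * ψ (t • p) :=
      fun t => (hexp y).mul (hψt t)
    have c' : ∀ t : ℝ, 0 < t → HasCompactSupport fun p =>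
        Complex.exp (Complex.I * (B p y : ℝ)) * ψ (t • p) := fun t ht => (hψt' t ht).mul_left
    have h0 := hF₀ (fun p => Complex.exp (Complex.I * (B p y : ℝ)) * ψ (t • p) -
      Complex.exp (Complex.I * (B p y : ℝ)) * ψ (t' • p)) ((c t).sub (c t'))
      ((c' t ht).sub (c' t' ht')) (by
        rw [notMem_tsupport_iff_eventuallyEq]
        filter_upwards [hψt₁ t, hψt₁ t'] with p h1 h2
        simp [h1, h2])
    simp only [formFourier_sub (c t).continuous (c' t ht) (c t').continuous (c' t' ht'),
      mul_sub] at h0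
    rw [integral_sub (integrable_mul_formFourier hB (c t) (c' t ht) hF hC)
      (integrable_mul_formFourier hB (c t') (c' t' ht') hF hC), ← hN t ht, ← hN t' ht'] at h0
    exact sub_eq_zero.1 h0
  obtain ⟨K, hK, hKg⟩ := exists_integral_formFourier hB
  have hK' : ∫ u, h u = K := by
    rw [hKg ψ hψ hψ', hψ₁.self_of_nhds, mul_one]
  have hsmall : ∀ y, Tendsto (fun t => N t y) (𝓝[>] 0) (𝓝 (F y * K)) := by
    intro y
    have e : F y * K = ∫ u, F y * h u := by rw [integral_const_mul, hK']
    rw [e]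
    refine tendsto_integral_filter_of_dominated_convergence (fun u => C * ‖h u‖) ?_ ?_
      (hhi.norm.const_mul C) ?_
    · exact Eventually.of_forall fun t => (by fun_prop : Continuous fun u =>
        F (t • u + y) * h u).aestronglyMeasurable
    · refine Eventually.of_forall fun t => Eventually.of_forall fun u => ?_
      rw [norm_mul]
      gcongr
      exact hC _
    · refine Eventually.of_forall fun u => ?_
      have h1 : Continuous fun t : ℝ => F (t • u + y) * h u := by fun_prop
      have h2 := h1.tendsto 0
      simp only [zero_smul, zero_add] at h2
      exact h2.mono_left nhdsWithin_le_nhds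
  have hNF : ∀ t, 0 < t → ∀ y, N t y = F y * K := by
    intro t ht y
    refine tendsto_nhds_unique (tendsto_const_nhds.congr' ?_) (hsmall y)
    filter_upwards [self_mem_nhdsWithin] with t' ht'
    exact hNN t t' ht ht' y
  have hinv : Tendsto (fun t : ℝ => t⁻¹ • x) atTop (𝓝 0) := by
    simpa using (tendsto_inv_atTop_zero (𝕜 := ℝ)).smul_const x
  obtain ⟨D, hD₀, hD⟩ := exists_norm_formFourier_le hB hψ hψ'
  -- At scale `t` the displacement from `0` to `x` shifts the kernel by only `t⁻¹ • x`, so smearing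
  -- at large scales cannot distinguish the two points.
  have hlarge : Tendsto (fun t : ℝ => ∫ u, F (t • u) * (h (u - t⁻¹ • x) - h u)) atTop (𝓝 0) := by
    have e : (0 : ℂ) = ∫ _ : Fin d → ℝ, 0 := by simp
    rw [e]
    refine tendsto_integral_filter_of_dominated_convergence
      (fun u => C * (D * (2 ^ (d + 1 : ℝ) * (1 + ‖u‖) ^ (-(d + 1 : ℝ))) +
        D * (1 + ‖u‖) ^ (-(d + 1 : ℝ)))) ?_ ?_ ?_ ?_
    · exact Eventually.of_forall fun t => (by fun_prop : Continuous fun u =>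
        F (t • u) * (h (u - t⁻¹ • x) - h u)).aestronglyMeasurable
    · have h1 : ∀ᶠ t : ℝ in atTop, ‖t⁻¹ • x‖ ≤ 1 := by
        have := hinv.norm
        rw [norm_zero] at this
        exact this.eventually (ge_mem_nhds one_pos)
      filter_upwards [h1] with t ht
      refine Eventually.of_forall fun u => ?_
      rw [norm_mul]
      refine mul_le_mul (hC _) ((norm_sub_le _ _).trans (add_le_add ?_ (hD u)))
        (norm_nonneg _) ((norm_nonneg _).trans (hC 0))
      exact (hD _).trans (mul_le_mul_of_nonneg_left (rpow_one_add_norm_sub_le u _ ht) hD₀)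
    · exact ((((integrable_one_add_norm_pi d).const_mul _).const_mul D).add
        ((integrable_one_add_norm_pi d).const_mul D)).const_mul C
    · refine Eventually.of_forall fun u => ?_
      have h1 : Tendsto (fun t : ℝ => h (u - t⁻¹ • x) - h u) atTop (𝓝 0) := by
        have h2 := ((hh.tendsto (u - 0)).comp (hinv.const_sub u)).sub_const (h u)
        simpa using h2
      refine squeeze_zero_norm (a := fun t : ℝ => C * ‖h (u - t⁻¹ • x) - h u‖) (fun t => ?_) ?_
      · rw [norm_mul]
        gcongr
        exact hC _
      · simpa using h1.norm.const_mul C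
  have hconst : ∀ t : ℝ, 0 < t →
      ∫ u, F (t • u) * (h (u - t⁻¹ • x) - h u) = F x * K - F 0 * K := by
    intro t ht
    rw [← hNF t ht x, ← hNF t ht 0]
    simp only [N, add_zero, mul_sub]
    have h1 := integral_sub_right_eq_self (μ := (volume : Measure (Fin d → ℝ)))
      (fun u => F (t • u + x) * h u) (t⁻¹ • x)
    simp only [smul_sub, smul_smul, mul_inv_cancel₀ ht.ne', one_smul, sub_add_cancel] at h1
    rw [← h1]
    refine integral_sub ?_ ?_
    · exact (hhi.comp_sub_right (t⁻¹ • x)).bdd_mul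
        (by fun_prop : Continuous fun u => F (t • u)).aestronglyMeasurable
        (Eventually.of_forall fun u => hC _)
    · exact hhi.bdd_mul (by fun_prop : Continuous fun u => F (t • u)).aestronglyMeasurable
        (Eventually.of_forall fun u => hC _)
  have h0 : F x * K - F 0 * K = 0 := by
    refine tendsto_nhds_unique (tendsto_const_nhds.congr' ?_) hlarge
    filter_upwards [eventually_gt_atTop 0] with t ht
    exact (hconst t ht).symm
  exact mul_right_cancel₀ hK (sub_eq_zero.1 h0)

/-- A bounded function whose Fourier transform is supported at `q` is a multiple of the character
`x ↦ e^{iqx}`. -/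
theorem eq_exp_mul_of_fourierSupport_subset (hB : ∀ x, (∀ p, B p x = 0) → x = 0)
    (hF : Continuous F) {C : ℝ} (hC : ∀ x, ‖F x‖ ≤ C) {q : Fin d → ℝ}
    (hq : fourierSupport B F ⊆ {q}) (x : Fin d → ℝ) :
    F x = Complex.exp (Complex.I * (B q x : ℝ)) * F 0 := by
  have hBc : Continuous fun x => B q x := (B q).continuous_of_finiteDimensional
  have hn : ∀ x, ‖Complex.exp (-Complex.I * (B q x : ℝ)) * F x‖ ≤ C := fun x => by
    have e : -Complex.I * (B q x : ℝ) = ((-B q x : ℝ) : ℂ) * Complex.I := by push_cast; ring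
    rw [norm_mul, e, Complex.norm_exp_ofReal_mul_I, one_mul]
    exact hC x
  -- The twist by `e^{-iqx}` moves the support from `q` to the origin.
  have h := eq_apply_zero_of_formFourier (F := fun x => Complex.exp (-Complex.I * (B q x : ℝ)) * F x)
    hB (by fun_prop) hn (fun g hg hg' h0 => ?_) x
  · simp only [map_zero, Complex.ofReal_zero, mul_zero, Complex.exp_zero, one_mul] at h
    rw [← h, ← mul_assoc, ← Complex.exp_add]
    simp
  · have e : ∀ x, Complex.exp (-Complex.I * (B q x : ℝ)) * F x * formFourier B g x =
        F x * formFourier B (fun p => g (p - q)) x := fun x => by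
      rw [formFourier_comp_sub]; ring
    simp only [e]
    refine integral_mul_formFourier_eq_zero hB hF hC (hg.comp (contDiff_id.sub contDiff_const))
      (hg'.comp_homeomorph (Homeomorph.subRight q)) ?_
    refine (Set.disjoint_singleton_right.2 ?_).mono_right hq
    rw [notMem_tsupport_iff_eventuallyEq] at h0 ⊢
    have ht : Tendsto (fun p : Fin d → ℝ => p - q) (𝓝 q) (𝓝 0) := by
      simpa using (by fun_prop : Continuous fun p : Fin d → ℝ => p - q).tendsto q
    exact ht.eventually h0

/-- By inversion at the origin, the transform of a constant is a multiple of the delta distribution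
at `0`. -/
theorem fourierSupport_const_subset (hB : ∀ x, (∀ p, B p x = 0) → x = 0) (c : ℂ) :
    fourierSupport B (fun _ => c) ⊆ {0} := by
  intro p hp
  by_contra h
  obtain ⟨K, -, hK⟩ := exists_integral_formFourier hB
  obtain ⟨g, hg, hg', hgs, hne⟩ := hp {0}ᶜ isOpen_compl_singleton h
  refine hne ((fourierPairing_eq_zero_iff _ _ _).2 ?_)
  rw [integral_const_mul, hK g hg hg', image_eq_zero_of_notMem_tsupport (fun h0 => hgs h0 rfl)]
  simp

theorem zero_mem_fourierSupport_const (hB : ∀ x, (∀ p, B p x = 0) → x = 0) {c : ℂ}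
    (hc : c ≠ 0) : 0 ∈ fourierSupport B (fun _ => c) := by
  intro V hV h0
  obtain ⟨K, hK, hKg⟩ := exists_integral_formFourier hB
  obtain ⟨f, hfs, hfc, hf, -, hf₀⟩ := exists_contDiff_tsupport_subset (n := ⊤) (hV.mem_nhds h0)
  have hg : ContDiff ℝ ∞ fun p => (f p : ℂ) := Complex.ofRealCLM.contDiff.comp hf
  have hg' : HasCompactSupport fun p => (f p : ℂ) := hfc.comp_left Complex.ofReal_zero
  refine ⟨fun p => (f p : ℂ), hg, hg', ?_, ?_⟩
  · refine Set.Subset.trans (closure_mono (t := Function.support f) fun p hp h => hp ?_) hfs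
    simp only [h, Complex.ofReal_zero]
  · rw [Ne, fourierPairing_eq_zero_iff, integral_const_mul, hKg _ hg hg', hf₀]
    simp [hc, hK]

end PointSupport

namespace IsometryGroup

/-! ### Spectral decomposition relative to an invariant vector and an invariant functional -/

variable {d : ℕ} {E F : Type*} [NormedAddCommGroup E] [NormedSpace ℂ E]
    [NormedAddCommGroup F] [NormedSpace ℂ F] {α : IsometryGroup d E F}
    {B : LinearMap.BilinForm ℝ (Fin d → ℝ)} {l : ℝ → Fin d → ℝ} {e : E} {η : F}

theorem volume_Icc_neg_pos {l : Fin d → ℝ} (hl : ∀ i, 0 < l i) :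
    0 < (volume (Set.Icc (-l) l)).toReal := by
  rw [Real.volume_Icc_pi_toReal (fun i => by simpa using (neg_neg_of_pos (hl i)).trans (hl i) |>.le)]
  exact Finset.prod_pos fun i _ => by simpa using (neg_neg_of_pos (hl i)).trans (hl i)

theorem mean_eq_of_forall_eq {l q : Fin d → ℝ} (hl : ∀ i, 0 < l i) {φ : F} {A : E} {c : ℂ}
    (h : ∀ x, Complex.exp (-Complex.I * (B q x : ℝ)) * α.pairing φ (α.act x A) = c) :
    α.mean B l q φ A = c := by
  simp only [mean, h, setIntegral_const, measureReal_def]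
  rw [Complex.real_smul, ← mul_assoc, ← Complex.ofReal_mul,
    inv_mul_cancel₀ (volume_Icc_neg_pos hl).ne', Complex.ofReal_one, one_mul]

/-- A constant is its own mean over every cuboid of positive volume. Both the bound on the
continuous subspace and the identification of the eigenvectors rest on this. -/
theorem eq_zero_of_mem_continuousSubspace (hl : ∀ᶠ L in atTop, ∀ i, 0 < l L i) {A : E}
    (hA : A ∈ α.continuousSubspace B l) {q : Fin d → ℝ} {φ : F} {c : ℂ}
    (h : ∀ x, Complex.exp (-Complex.I * (B q x : ℝ)) * α.pairing φ (α.act x A) = c) : c = 0 := by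
  refine tendsto_nhds_unique (tendsto_const_nhds.congr' ?_) (hA q φ)
  filter_upwards [hl] with L hL
  exact (mean_eq_of_forall_eq hL h).symm

theorem continuousSubspace_eq_ker (hl : ∀ᶠ L in atTop, ∀ i, 0 < l L i)
    (hη : ∀ x A, α.pairing η (α.act x A) = α.pairing η A)
    (hker : LinearMap.ker (α.pairing η) ≤ α.continuousSubspace B l) :
    α.continuousSubspace B l = LinearMap.ker (α.pairing η) := by
  refine le_antisymm (fun A hA => ?_) hker
  exact eq_zero_of_mem_continuousSubspace hl hA (q := 0) (φ := η) fun x => by simp [hη]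

theorem pairing_act_eq (hB : ∀ x, (∀ p, B p x = 0) → x = 0) {A : E} {q : Fin d → ℝ}
    (hA : A ∈ α.spectralSubspace B {q}) (φ : F) (x : Fin d → ℝ) :
    α.pairing φ (α.act x A) = Complex.exp (Complex.I * (B q x : ℝ)) * α.pairing φ A := by
  have h := eq_exp_mul_of_fourierSupport_subset hB (α.continuous_pairing φ A)
    (C := ‖φ‖ * ‖A‖) (fun x => by simpa using α.norm_pairing_le φ (α.act x A)) (hA φ) x
  rwa [α.act_zero] at h

theorem sub_smul_mem_ker (hηe : α.pairing η e = 1) (A : E) :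
    A - α.pairing η A • e ∈ LinearMap.ker (α.pairing η) := by
  simp [hηe]

/-- For `A` with spectrum in `{q}`, the element `A - η(A)e` is continuous by `hker` and also an
eigenvector for `q`, hence zero. The closure adds nothing, since a line is closed. -/
theorem purePointSubspace_eq_span (hB : ∀ x, (∀ p, B p x = 0) → x = 0)
    (hl : ∀ᶠ L in atTop, ∀ i, 0 < l L i) (he : ∀ x, α.act x e = e)
    (hη : ∀ x A, α.pairing η (α.act x A) = α.pairing η A) (hηe : α.pairing η e = 1)
    (hsep : ∀ A, (∀ φ, α.pairing φ A = 0) → A = 0)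
    (hker : LinearMap.ker (α.pairing η) ≤ α.continuousSubspace B l) :
    α.purePointSubspace B = Submodule.span ℂ {e} := by
  refine le_antisymm ?_ ?_
  · refine Submodule.topologicalClosure_minimal _ (Submodule.span_le.2 ?_)
      (Submodule.closed_of_finiteDimensional _)
    refine Set.iUnion₂_subset fun q _ A hA => ?_
    have hA' : A - α.pairing η A • e ∈ α.continuousSubspace B l :=
      hker (sub_smul_mem_ker hηe A)
    -- Invariance of `η` forces either `η(A) = 0` or the character of `q` to be trivial. In both
    -- cases `η(A)e` is an eigenvector for `q` too.
    have hc : ∀ x, Complex.exp (-Complex.I * (B q x : ℝ)) * α.pairing η A = α.pairing η A :=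
      fun x => by
        have h := pairing_act_eq hB hA η x
        rw [hη] at h
        conv_lhs => rw [h, ← mul_assoc, ← Complex.exp_add]
        simp
    have h0 : A - α.pairing η A • e = 0 := hsep _ fun φ => by
      refine eq_zero_of_mem_continuousSubspace hl hA' (q := q) (φ := φ) fun x => ?_
      simp only [map_sub, map_smul, he, smul_eq_mul, mul_sub, pairing_act_eq hB hA φ x]
      rw [← mul_assoc, ← mul_assoc, hc, ← Complex.exp_add]
      simp
    rw [sub_eq_zero.1 h0]
    exact Submodule.smul_mem _ _ (Submodule.mem_span_singleton_self e)
  · rw [Submodule.span_singleton_le_iff_mem]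
    refine Submodule.le_topologicalClosure _ (Submodule.subset_span ?_)
    -- The coefficients of `e` are constants, so its spectrum is in `{0}`; the coefficient with `η`
    -- is `1`, which puts `0` in the spectrum.
    refine Set.mem_iUnion₂.2 ⟨0, subset_closure ?_, fun φ => ?_⟩
    · simp only [Set.mem_iUnion]
      refine ⟨e, trivial, η, ?_⟩
      simp only [he, hηe]
      exact zero_mem_fourierSupport_const hB one_ne_zero
    · simp only [he]
      exact fourierSupport_const_subset hB _

theorem isCompl_span_ker (hηe : α.pairing η e = 1) :
    IsCompl (Submodule.span ℂ {e}) (LinearMap.ker (α.pairing η)) := by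
  refine ⟨Submodule.disjoint_def.2 fun A hA hA' => ?_, codisjoint_iff.2 (eq_top_iff.2 ?_)⟩
  · obtain ⟨c, rfl⟩ := Submodule.mem_span_singleton.1 hA
    have hc : c = 0 := by simpa [hηe] using hA'
    rw [hc, zero_smul]
  · intro A _
    refine Submodule.mem_sup.2 ⟨α.pairing η A • e, Submodule.smul_mem _ _
      (Submodule.mem_span_singleton_self e), A - α.pairing η A • e, sub_smul_mem_ker hηe A,
      add_sub_cancel _ _⟩

end IsometryGroup

/-! ### Commutants of irreducible algebras -/

section Schur

variable {H : Type*} [NormedAddCommGroup H] [InnerProductSpace ℂ H] [CompleteSpace H]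
  {M : StarSubalgebra ℂ (H →L[ℂ] H)}

/-- The kernel of `S` is closed and invariant under `M`, so `S` is either injective or zero. -/
theorem ActsIrreducibly.eq_zero_or_eq_zero (hM : ActsIrreducibly M) {S T : H →L[ℂ] H}
    (hS : ∀ A ∈ M, A * S = S * A) (hST : S * T = 0) : S = 0 ∨ T = 0 := by
  have hinv : ∀ A ∈ M, ∀ v ∈ S.ker, A v ∈ S.ker := fun A hA v hv => by
    have h : A (S v) = S (A v) := congrArg (fun f : H →L[ℂ] H => f v) (hS A hA)
    change S v = 0 at hv
    change S (A v) = 0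
    rw [← h, hv, map_zero]
  rcases hM S.ker S.isClosed_ker hinv with h | h
  · refine Or.inr (ContinuousLinearMap.ext fun v => ?_)
    have hv : T v ∈ S.ker := congrArg (fun f : H →L[ℂ] H => f v) hST
    rw [h] at hv
    exact hv
  · refine Or.inl (ContinuousLinearMap.ext fun v => ?_)
    have hv : v ∈ S.ker := h ▸ Submodule.mem_top
    exact hv

/-- Two distinct spectral points would yield, by functional calculus, two nonzero operators in the
commutant with product zero. -/
theorem ActsIrreducibly.exists_eq_smul_of_isSelfAdjoint [Nontrivial H] (hM : ActsIrreducibly M)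
    {T : H →L[ℂ] H} (hT : ∀ A ∈ M, A * T = T * A) (hsa : IsSelfAdjoint T) :
    ∃ c : ℂ, T = c • 1 := by
  obtain ⟨a, ha⟩ : (spectrum ℝ T).Nonempty := ContinuousFunctionalCalculus.spectrum_nonempty T hsa
  suffices h : spectrum ℝ T ⊆ {a} by
    refine ⟨(a : ℂ), ?_⟩
    rw [CFC.eq_algebraMap_of_spectrum_subset_singleton T a h]
    ext v
    simp [Algebra.algebraMap_eq_smul_one]
  suffices h : ∀ a ∈ spectrum ℝ T, ∀ b ∈ spectrum ℝ T, ¬ a < b by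
    intro b hb
    exact le_antisymm (not_lt.1 (h a ha b hb)) (not_lt.1 (h b hb a ha))
  intro a ha b hb hab
  have hz : ∀ f : ℝ → ℝ, Continuous f → ∀ t ∈ spectrum ℝ T, cfc f T = 0 → f t = 0 := by
    intro f hf t ht h
    have h1 : f t ∈ spectrum ℝ (cfc f T) := by
      rw [cfc_map_spectrum f T hsa hf.continuousOn]
      exact ⟨t, ht, rfl⟩
    rwa [h, spectrum.zero_eq] at h1
  -- The parts of `t` below and above the midpoint: their product is zero, but the first is positive
  -- at `a` and the second at `b`.
  have hf : Continuous fun t : ℝ => max ((a + b) / 2 - t) 0 := by fun_prop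
  have hg : Continuous fun t : ℝ => max (t - (a + b) / 2) 0 := by fun_prop
  have hfg : cfc (fun t : ℝ => max ((a + b) / 2 - t) 0) T *
      cfc (fun t : ℝ => max (t - (a + b) / 2) 0) T = 0 := by
    rw [← cfc_mul _ _ T hf.continuousOn hg.continuousOn]
    have h0 : (fun t : ℝ => max ((a + b) / 2 - t) 0 * max (t - (a + b) / 2) 0) = fun _ => 0 := by
      funext t
      rcases le_total t ((a + b) / 2) with h | h
      · rw [max_eq_right (sub_nonpos.2 h), mul_zero]
      · rw [max_eq_right (sub_nonpos.2 h), zero_mul]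
    rw [h0, cfc_const_zero]
  rcases hM.eq_zero_or_eq_zero (fun A hA =>
    (Commute.cfc_real (show Commute T A from (hT A hA).symm) _).symm) hfg with h | h
  · have := hz _ hf a ha h
    have := le_max_left ((a + b) / 2 - a) 0
    linarith
  · have := hz _ hg b hb h
    have := le_max_left (b - (a + b) / 2) 0
    linarith

/-- Schur's lemma. -/
theorem ActsIrreducibly.exists_eq_smul [Nontrivial H] (hM : ActsIrreducibly M)
    {T : H →L[ℂ] H} (hT : ∀ A ∈ M, A * T = T * A) : ∃ c : ℂ, T = c • 1 := by
  have hT' : ∀ A ∈ M, A * star T = star T * A := fun A hA => by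
    have h := congrArg star (hT (star A) (star_mem hA))
    simpa using h.symm
  obtain ⟨a, ha⟩ := hM.exists_eq_smul_of_isSelfAdjoint (T := T + star T)
    (fun A hA => by rw [mul_add, add_mul, hT A hA, hT' A hA]) (IsSelfAdjoint.add_star_self T)
  obtain ⟨b, hb⟩ := hM.exists_eq_smul_of_isSelfAdjoint (T := Complex.I • (T - star T))
    (fun A hA => by rw [mul_smul_comm, smul_mul_assoc, mul_sub, sub_mul, hT A hA, hT' A hA]) (by
      rw [isSelfAdjoint_iff, star_smul, star_sub, star_star, Complex.star_def, Complex.conj_I,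
        neg_smul, ← smul_neg, neg_sub])
  refine ⟨(1 / 2) * (a - Complex.I * b), ?_⟩
  have h : T = (1 / 2 : ℂ) • ((T + star T) - Complex.I • (Complex.I • (T - star T))) := by
    rw [smul_smul, Complex.I_mul_I]
    module
  rw [h, ha, hb]
  module

end Schur

namespace QuantumFieldTheory

variable {s : ℕ} {H : Type*} [NormedAddCommGroup H] [InnerProductSpace ℂ H] [CompleteSpace H]
  (Q : QuantumFieldTheory s H)

/-! ### Asymptotic commutativity -/

/-- One space coordinate exceeding the time coordinate suffices. The two points of the regions
change each of these differences by at most `2R`, whence `4R`. -/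
theorem spacelikeSeparated_image_add {O₁ O₂ : Set (Fin (s + 1) → ℝ)} {R : ℝ}
    (h₁ : ∀ y ∈ O₁, ‖y‖ ≤ R) (h₂ : ∀ y ∈ O₂, ‖y‖ ≤ R) {x : Fin (s + 1) → ℝ} {k : Fin s}
    (hx : |x 0| + 4 * R < |x k.succ|) : SpacelikeSeparated ((fun y => y + x) '' O₁) O₂ := by
  rintro _ ⟨y, hy, rfl⟩ z hz
  have hy' : ∀ i, |y i| ≤ R := fun i => (norm_le_pi_norm y i).trans (h₁ y hy)
  have hz' : ∀ i, |z i| ≤ R := fun i => (norm_le_pi_norm z i).trans (h₂ z hz)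
  have hlt : |(y + x - z) 0| < |(y + x - z) k.succ| := by
    have := hy' 0
    have := hz' 0
    have := hy' k.succ
    have := hz' k.succ
    simp only [Pi.sub_apply, Pi.add_apply]
    have a1 : |y 0 + x 0 - z 0| ≤ |y 0| + |x 0| + |z 0| :=
      (abs_sub _ _).trans (by gcongr; exact abs_add_le _ _)
    have a2 : |x k.succ| ≤ |y k.succ + x k.succ - z k.succ| + |y k.succ| + |z k.succ| := by
      have e : x k.succ = (y k.succ + x k.succ - z k.succ) - y k.succ + z k.succ := by ring
      conv_lhs => rw [e]
      exact (abs_add_le _ _).trans (by gcongr; exact abs_sub _ _)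
    linarith
  have hsq := sq_lt_sq.2 hlt
  have hsum : (y + x - z) k.succ * (y + x - z) k.succ ≤
      ∑ i : Fin s, (y + x - z) i.succ * (y + x - z) i.succ :=
    Finset.single_le_sum (f := fun i : Fin s => (y + x - z) i.succ * (y + x - z) i.succ)
      (fun i _ => mul_self_nonneg _) (Finset.mem_univ k)
  simp only [minkowskiForm, LinearMap.mk₂_apply]
  nlinarith

/-- The points which are not far out in the spacelike directions. -/
def nearRegion (s : ℕ) (R : ℝ) : Set (Fin (s + 1) → ℝ) :=
  {x | ∀ k : Fin s, |x k.succ| ≤ |x 0| + R}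

theorem isClosed_nearRegion (s : ℕ) (R : ℝ) : IsClosed (nearRegion s R) := by
  simp only [nearRegion, Set.ofPred_forall]
  exact isClosed_iInter fun k => isClosed_le (by fun_prop) (by fun_prop)

theorem exists_commute {A C : H →L[ℂ] H} (hA : A ∈ Q.localOperators)
    (hC : C ∈ Q.localOperators) : ∃ R, ∀ x ∉ nearRegion s R,
      (Q.U x : H →L[ℂ] H) * A * star (Q.U x : H →L[ℂ] H) * C =
        C * ((Q.U x : H →L[ℂ] H) * A * star (Q.U x : H →L[ℂ] H)) := by
  obtain ⟨O₁, o₁, b₁, m₁⟩ := hA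
  obtain ⟨O₂, o₂, b₂, m₂⟩ := hC
  obtain ⟨R₁, hR₁⟩ := b₁.exists_norm_le
  obtain ⟨R₂, hR₂⟩ := b₂.exists_norm_le
  refine ⟨4 * max R₁ R₂, fun x hx => ?_⟩
  simp only [nearRegion, Set.mem_ofPred_eq, not_forall, not_le] at hx
  obtain ⟨k, hk⟩ := hx
  refine Q.locality _ _ ((Homeomorph.addRight x).isOpenMap O₁ o₁)
    ((isometry_add_right x).lipschitz.isBounded_image b₁) o₂ b₂
    (spacelikeSeparated_image_add (fun y hy => (hR₁ y hy).trans (le_max_left _ _))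
      (fun y hy => (hR₂ y hy).trans (le_max_right _ _)) hk) _ ?_ _ m₂
  have hm : (Q.U x : H →L[ℂ] H) * A * star (Q.U x : H →L[ℂ] H) ∈
      (fun A => (Q.U x : H →L[ℂ] H) * A * star (Q.U x : H →L[ℂ] H)) ''
        (Q.net O₁ : Set (H →L[ℂ] H)) := ⟨A, m₁, rfl⟩
  rwa [Q.covariance x O₁ o₁ b₁] at hm

/-- The norm of the commutator of `α_x(A)` and `C`. -/
def commutatorNorm (A : Q.algebra) (C : H →L[ℂ] H) (x : Fin (s + 1) → ℝ) : ℝ :=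
  ‖(Q.translation x A : H →L[ℂ] H) * C - C * (Q.translation x A : H →L[ℂ] H)‖

theorem norm_translation (A : Q.algebra) (x : Fin (s + 1) → ℝ) :
    ‖(Q.translation x A : H →L[ℂ] H)‖ = ‖A‖ :=
  (Q.translation x).norm_map A

theorem norm_commutator_le (S T : H →L[ℂ] H) : ‖S * T - T * S‖ ≤ 2 * ‖S‖ * ‖T‖ := by
  have h1 := norm_sub_le (S * T) (T * S)
  have h2 := norm_mul_le S T
  have h3 := norm_mul_le T S
  linarith

theorem commutatorNorm_le (A : Q.algebra) (C : H →L[ℂ] H) (x : Fin (s + 1) → ℝ) :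
    Q.commutatorNorm A C x ≤ 2 * ‖A‖ * ‖C‖ := by
  have h := norm_commutator_le (Q.translation x A : H →L[ℂ] H) C
  rwa [norm_translation] at h

theorem commutatorNorm_le_add (A A' : Q.algebra) (C : H →L[ℂ] H) (x : Fin (s + 1) → ℝ) :
    Q.commutatorNorm A C x ≤ Q.commutatorNorm A' C x + 2 * ‖A - A'‖ * ‖C‖ := by
  have h := Q.commutatorNorm_le (A - A') C x
  have e : (Q.translation x A : H →L[ℂ] H) * C - C * (Q.translation x A : H →L[ℂ] H) =
      ((Q.translation x A' : H →L[ℂ] H) * C - C * (Q.translation x A' : H →L[ℂ] H)) +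
      ((Q.translation x (A - A') : H →L[ℂ] H) * C -
        C * (Q.translation x (A - A') : H →L[ℂ] H)) := by
    rw [map_sub]
    push_cast
    noncomm_ring
  rw [commutatorNorm, e]
  exact (norm_add_le _ _).trans (add_le_add le_rfl h)

theorem continuous_coe_translation (A : Q.algebra) :
    Continuous fun x => (Q.translation x A : H →L[ℂ] H) :=
  continuous_subtype_val.comp (Q.translation_continuous A)

theorem continuous_commutatorNorm (A : Q.algebra) (C : H →L[ℂ] H) :
    Continuous (Q.commutatorNorm A C) := by
  have := Q.continuous_coe_translation A
  unfold commutatorNorm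
  fun_prop

/-! ### Averages with respect to measures of mass at most one -/

theorem measure_real_le_one {X : Type*} [MeasurableSpace X] {μ : ℝ → Measure X}
    (hμ : ∀ L, μ L Set.univ ≤ 1) (L : ℝ) (S : Set X) :
    (μ L).real S ≤ 1 :=
  ENNReal.toReal_le_of_le_ofReal zero_le_one
    (by simpa using (measure_mono (Set.subset_univ S)).trans (hμ L))

theorem norm_integral_le_of_bounded {X : Type*} [MeasurableSpace X] {μ : ℝ → Measure X}
    (hμ : ∀ L, μ L Set.univ ≤ 1) (L : ℝ) {f : X → ℂ} {C : ℝ} (hC₀ : 0 ≤ C) (hC : ∀ x, ‖f x‖ ≤ C) : ‖∫ x, f x ∂(μ L)‖ ≤ C := by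
  have : IsFiniteMeasure (μ L) := ⟨(hμ L).trans_lt ENNReal.one_lt_top⟩
  refine (norm_integral_le_of_norm_le_const (Eventually.of_forall hC)).trans ?_
  exact mul_le_of_le_one_right hC₀ (measure_real_le_one hμ L _)

variable {X : Type*} [TopologicalSpace X] [MeasurableSpace X] [BorelSpace X]
  {μ : ℝ → Measure X} {j : X → Fin (s + 1) → ℝ} {k : X → ℂ}

theorem integrable_of_continuous_of_bounded {E : Type*} [NormedAddCommGroup E]
    [SecondCountableTopology E]
    (hμ : ∀ L, μ L Set.univ ≤ 1) (L : ℝ) {f : X → E} (hf : Continuous f) {C : ℝ}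
    (hC : ∀ x, ‖f x‖ ≤ C) : Integrable f (μ L) := by
  have : IsFiniteMeasure (μ L) := ⟨(hμ L).trans_lt ENNReal.one_lt_top⟩
  exact Integrable.of_bound hf.aestronglyMeasurable C (Eventually.of_forall hC)

/-- The commutator vanishes off some near region and is bounded by `2‖A‖‖C‖` on it, so its average
is controlled by the mass of that region. -/
theorem tendsto_integral_commutatorNorm_of_local (hμ : ∀ L, μ L Set.univ ≤ 1)
    (hj : Continuous j)
    (hfar : ∀ R, Tendsto (fun L => (μ L).real (j ⁻¹' nearRegion s R)) atTop (𝓝 0))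
    {A : Q.algebra} (hA : (A : H →L[ℂ] H) ∈ Q.localOperators) {C : H →L[ℂ] H}
    (hC : C ∈ Q.localOperators) :
    Tendsto (fun L => ∫ x, Q.commutatorNorm A C (j x) ∂(μ L)) atTop (𝓝 0) := by
  obtain ⟨R, hR⟩ := Q.exists_commute hA hC
  have hm : MeasurableSet (j ⁻¹' nearRegion s R) :=
    ((isClosed_nearRegion s R).preimage hj).measurableSet
  refine squeeze_zero (g := fun L => 2 * ‖A‖ * ‖C‖ * (μ L).real (j ⁻¹' nearRegion s R))
    (fun L => integral_nonneg fun x => norm_nonneg _) (fun L => ?_) ?_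
  · have : IsFiniteMeasure (μ L) := ⟨(hμ L).trans_lt ENNReal.one_lt_top⟩
    have e : ∫ x, (j ⁻¹' nearRegion s R).indicator (fun _ => 2 * ‖A‖ * ‖C‖) x ∂(μ L) =
        2 * ‖A‖ * ‖C‖ * (μ L).real (j ⁻¹' nearRegion s R) := by
      rw [integral_indicator_const _ hm, smul_eq_mul, mul_comm]
    rw [← e]
    refine integral_mono (integrable_of_continuous_of_bounded hμ L
      ((Q.continuous_commutatorNorm A C).comp hj) (C := 2 * ‖A‖ * ‖C‖) fun x => ?_)
      ((integrable_const _).indicator hm) fun x => ?_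
    · rw [commutatorNorm, norm_norm]
      exact Q.commutatorNorm_le A C (j x)
    · by_cases hx : x ∈ j ⁻¹' nearRegion s R
      · rw [Set.indicator_of_mem hx]
        exact Q.commutatorNorm_le A C (j x)
      · rw [Set.indicator_of_notMem hx]
        refine le_of_eq (norm_eq_zero.2 (sub_eq_zero.2 (hR (j x) hx)))
  · simpa using (hfar R).const_mul (2 * ‖A‖ * ‖C‖)

/-- Approximating `A` by a local operator costs an error uniform in `x`, hence also in the average.
`C` may stay local, since commuting with local operators already forces a scalar. -/
theorem tendsto_integral_commutatorNorm (hμ : ∀ L, μ L Set.univ ≤ 1) (hj : Continuous j)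
    (hfar : ∀ R, Tendsto (fun L => (μ L).real (j ⁻¹' nearRegion s R)) atTop (𝓝 0))
    (A : Q.algebra) {C : H →L[ℂ] H} (hC : C ∈ Q.localOperators) :
    Tendsto (fun L => ∫ x, Q.commutatorNorm A C (j x) ∂(μ L)) atTop (𝓝 0) := by
  have hint : ∀ A L, Integrable (fun x => Q.commutatorNorm A C (j x)) (μ L) := fun A L =>
    integrable_of_continuous_of_bounded hμ L ((Q.continuous_commutatorNorm A C).comp hj)
      (C := 2 * ‖A‖ * ‖C‖) fun x => by
        rw [commutatorNorm, norm_norm]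
        exact Q.commutatorNorm_le A C (j x)
  have h0 : ∀ A L, 0 ≤ ∫ x, Q.commutatorNorm A C (j x) ∂(μ L) := fun A L =>
    integral_nonneg fun x => norm_nonneg _
  rw [Metric.tendsto_nhds]
  intro ε hε
  have hδ : 0 < ε / 2 / (2 * ‖C‖ + 1) := by positivity
  obtain ⟨A', hA', hd⟩ := Metric.mem_closure_iff.1 A.2 _ hδ
  let A'' : Q.algebra := ⟨A', subset_closure hA'⟩
  have hd' : 2 * ‖A - A''‖ * ‖C‖ ≤ ε / 2 := by
    have h1 : ‖A - A''‖ ≤ ε / 2 / (2 * ‖C‖ + 1) := by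
      rw [dist_eq_norm] at hd
      exact hd.le
    rw [le_div_iff₀ (by positivity)] at h1
    nlinarith [norm_nonneg (A - A''), norm_nonneg C]
  have ht := Q.tendsto_integral_commutatorNorm_of_local hμ hj hfar (A := A'') hA' hC
  filter_upwards [ht.eventually (gt_mem_nhds (half_pos hε))] with L hL
  rw [Real.dist_eq, sub_zero, abs_of_nonneg (h0 A L)]
  have : IsFiniteMeasure (μ L) := ⟨(hμ L).trans_lt ENNReal.one_lt_top⟩
  calc ∫ x, Q.commutatorNorm A C (j x) ∂(μ L)
      ≤ ∫ x, (Q.commutatorNorm A'' C (j x) + 2 * ‖A - A''‖ * ‖C‖) ∂(μ L) :=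
        integral_mono (hint A L) ((hint A'' L).add (integrable_const _)) fun x =>
          Q.commutatorNorm_le_add A A'' C (j x)
    _ = ∫ x, Q.commutatorNorm A'' C (j x) ∂(μ L) +
          (μ L).real Set.univ * (2 * ‖A - A''‖ * ‖C‖) := by
        rw [integral_add (hint A'' L) (integrable_const _), integral_const, smul_eq_mul]
    _ < ε / 2 + ε / 2 := by
        refine add_lt_add_of_lt_of_le hL (le_trans ?_ hd')
        exact mul_le_of_le_one_left (by positivity) (measure_real_le_one hμ L _)
    _ = ε := add_halves ε

end QuantumFieldTheory

namespace QuantumFieldTheory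

variable {s : ℕ} {H : Type*} [NormedAddCommGroup H] [InnerProductSpace ℂ H] [CompleteSpace H]
  (Q : QuantumFieldTheory s H)

/-! ### Weak limits of averages -/

theorem inner_translation_vacuum {Ω : H} (hΩ : Q.IsVacuumVector Ω) (x : Fin (s + 1) → ℝ)
    (A : Q.algebra) :
    inner ℂ Ω ((Q.translation x A : H →L[ℂ] H) Ω) = inner ℂ Ω ((A : H →L[ℂ] H) Ω) := by
  have hU : star (Q.U x : H →L[ℂ] H) Ω = Ω := by
    conv_lhs => rw [← hΩ.2 x]
    exact congrArg (fun f : H →L[ℂ] H => f Ω) (Unitary.star_mul_self_of_mem (Q.U x).2)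
  change inner ℂ Ω ((Q.U x : H →L[ℂ] H) ((A : H →L[ℂ] H) (star (Q.U x : H →L[ℂ] H) Ω))) = _
  rw [hU, ← ContinuousLinearMap.adjoint_inner_left, ← ContinuousLinearMap.star_eq_adjoint, hU]

theorem norm_weight_mul_inner_le {X : Type*} {j : X → Fin (s + 1) → ℝ} {k : X → ℂ}
    (hk : ∀ x, ‖k x‖ ≤ 1) (A : Q.algebra) (ψ χ : H) (x : X) :
    ‖k x * inner ℂ ψ ((Q.translation (j x) A : H →L[ℂ] H) χ)‖ ≤ ‖A‖ * ‖ψ‖ * ‖χ‖ := by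
  rw [norm_mul]
  calc ‖k x‖ * ‖inner ℂ ψ ((Q.translation (j x) A : H →L[ℂ] H) χ)‖
      ≤ 1 * (‖ψ‖ * (‖(Q.translation (j x) A : H →L[ℂ] H)‖ * ‖χ‖)) := by
        gcongr
        · exact hk x
        · exact (norm_inner_le_norm _ _).trans
            (by gcongr; exact ContinuousLinearMap.le_opNorm _ _)
    _ = ‖A‖ * ‖ψ‖ * ‖χ‖ := by rw [norm_translation]; ring

theorem continuous_weight_mul_inner {X : Type*} [TopologicalSpace X] {j : X → Fin (s + 1) → ℝ}
    {k : X → ℂ} (hj : Continuous j) (hkc : Continuous k) (A : Q.algebra) (ψ χ : H) :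
    Continuous fun x => k x * inner ℂ ψ ((Q.translation (j x) A : H →L[ℂ] H) χ) := by
  have h1 : Continuous fun x => (Q.translation (j x) A : H →L[ℂ] H) :=
    (Q.continuous_coe_translation A).comp hj
  exact hkc.mul (continuous_const.inner (h1.clm_apply continuous_const))

variable {X : Type*} [TopologicalSpace X] [MeasurableSpace X] [BorelSpace X]
  {μ : ℝ → Measure X} {j : X → Fin (s + 1) → ℝ} {k : X → ℂ}

theorem integrable_weight_mul_inner (hμ : ∀ L, μ L Set.univ ≤ 1) (hj : Continuous j)
    (hkc : Continuous k) (hk : ∀ x, ‖k x‖ ≤ 1) (A : Q.algebra) (ψ χ : H) (L : ℝ) :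
    Integrable (fun x => k x * inner ℂ ψ ((Q.translation (j x) A : H →L[ℂ] H) χ)) (μ L) :=
  integrable_of_continuous_of_bounded hμ L (Q.continuous_weight_mul_inner hj hkc A ψ χ)
    (Q.norm_weight_mul_inner_le hk A ψ χ)

/-- The difference is the average of `k(x) (ψ|[α_x(A), C]χ)`, bounded by the averaged commutator
norm because `‖k‖ ≤ 1`. -/
theorem tendsto_integral_commutator (hμ : ∀ L, μ L Set.univ ≤ 1) (hj : Continuous j)
    (hfar : ∀ R, Tendsto (fun L => (μ L).real (j ⁻¹' nearRegion s R)) atTop (𝓝 0))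
    (hkc : Continuous k) (hk : ∀ x, ‖k x‖ ≤ 1) (A : Q.algebra) {C : H →L[ℂ] H}
    (hC : C ∈ Q.localOperators) (ψ χ : H) :
    Tendsto (fun L => (∫ x, k x * inner ℂ ψ ((Q.translation (j x) A : H →L[ℂ] H) (C χ)) ∂(μ L)) -
      ∫ x, k x * inner ℂ (star C ψ) ((Q.translation (j x) A : H →L[ℂ] H) χ) ∂(μ L))
      atTop (𝓝 0) := by
  have ht := (Q.tendsto_integral_commutatorNorm hμ hj hfar A hC).mul_const (‖ψ‖ * ‖χ‖)
  rw [zero_mul] at ht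
  refine squeeze_zero_norm (fun L => ?_) ht
  rw [← integral_sub (Q.integrable_weight_mul_inner hμ hj hkc hk A _ _ L)
    (Q.integrable_weight_mul_inner hμ hj hkc hk A _ _ L), ← integral_mul_const]
  refine norm_integral_le_of_norm_le ?_ (Eventually.of_forall fun x => ?_)
  · refine (integrable_of_continuous_of_bounded hμ L
      ((Q.continuous_commutatorNorm A C).comp hj) (C := 2 * ‖A‖ * ‖C‖) fun x => ?_).mul_const _
    simp only [Function.comp_apply]
    rw [commutatorNorm, norm_norm]
    exact Q.commutatorNorm_le A C (j x)
  · rw [ContinuousLinearMap.star_eq_adjoint, ContinuousLinearMap.adjoint_inner_left, ← mul_sub,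
      ← inner_sub_right, norm_mul]
    have h2 := ((Q.translation (j x) A : H →L[ℂ] H) * C -
      C * (Q.translation (j x) A : H →L[ℂ] H)).le_opNorm χ
    calc ‖k x‖ * _ ≤ 1 * (‖ψ‖ * (Q.commutatorNorm A C (j x) * ‖χ‖)) := by
          gcongr
          · exact hk x
          · exact (norm_inner_le_norm _ _).trans (by gcongr; exact h2)
      _ = _ := by ring

/-- An operator which commutes with all local operators is a multiple of the identity. -/
theorem exists_eq_smul_of_commute_local {T : H →L[ℂ] H}
    (hT : ∀ C ∈ Q.localOperators, C * T = T * C) : ∃ c : ℂ, T = c • 1 := by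
  have : Nontrivial H := by
    by_contra h
    rw [not_nontrivial_iff_subsingleton] at h
    exact Q.infinite_dimensional inferInstance
  refine Q.irreducible.exists_eq_smul fun A hA => ?_
  have hcl : IsClosed {A : H →L[ℂ] H | A * T = T * A} :=
    isClosed_eq (by fun_prop) (by fun_prop)
  exact closure_minimal (fun C hC => hT C hC) hcl hA

theorem tendsto_integral_inner (hμ : ∀ L, μ L Set.univ ≤ 1) (hj : Continuous j)
    (hfar : ∀ R, Tendsto (fun L => (μ L).real (j ⁻¹' nearRegion s R)) atTop (𝓝 0))
    (hkc : Continuous k) (hk : ∀ x, ‖k x‖ ≤ 1) {Ω : H} (hΩ : Q.IsVacuumVector Ω)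
    {A : Q.algebra} (hA : A ∈ Q.kerVacuum Ω) (ψ χ : H) :
    Tendsto (fun L => ∫ x, k x * inner ℂ ψ ((Q.translation (j x) A : H →L[ℂ] H) χ) ∂(μ L))
      atTop (𝓝 0) := by
  let m : ℝ → H → H → ℂ := fun L ψ χ =>
    ∫ x, k x * inner ℂ ψ ((Q.translation (j x) A : H →L[ℂ] H) χ) ∂(μ L)
  have hm : ∀ L ψ χ, ‖m L ψ χ‖ ≤ ‖A‖ * ‖ψ‖ * ‖χ‖ := fun L ψ χ =>
    norm_integral_le_of_bounded hμ L (by positivity) (Q.norm_weight_mul_inner_le hk A ψ χ)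
  have hint := fun L ψ χ => Q.integrable_weight_mul_inner hμ hj hkc hk A ψ χ L
  -- Along an ultrafilter all the bounded matrix elements converge at once, so the limits form a
  -- sesquilinear form without extracting subsequences.
  rw [tendsto_iff_ultrafilter]
  intro 𝒰 h𝒰
  have hlim : ∀ ψ χ, ∃ z, Tendsto (fun L => m L ψ χ) 𝒰 (𝓝 z) := fun ψ χ => by
    obtain ⟨z, -, hz⟩ := (isCompact_closedBall (0 : ℂ) (‖A‖ * ‖ψ‖ * ‖χ‖)).ultrafilter_le_nhds
      (𝒰.map fun L => m L ψ χ) (by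
        rw [le_principal_iff]
        change ∀ᶠ L in 𝒰, m L ψ χ ∈ Metric.closedBall 0 _
        exact Eventually.of_forall fun L => by simpa using hm L ψ χ)
    exact ⟨z, hz⟩
  choose b hb using hlim
  have hadd₁ : ∀ ψ ψ' χ, b (ψ + ψ') χ = b ψ χ + b ψ' χ := fun ψ ψ' χ => by
    refine tendsto_nhds_unique (hb _ χ) (((hb ψ χ).add (hb ψ' χ)).congr fun L => ?_)
    simp only [m, inner_add_left, mul_add]
    exact (integral_add (hint L _ _) (hint L _ _)).symm
  have hadd₂ : ∀ ψ χ χ', b ψ (χ + χ') = b ψ χ + b ψ χ' := fun ψ χ χ' => by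
    refine tendsto_nhds_unique (hb ψ _) (((hb ψ χ).add (hb ψ χ')).congr fun L => ?_)
    simp only [m, map_add, inner_add_right, mul_add]
    exact (integral_add (hint L _ _) (hint L _ _)).symm
  have hsmul₁ : ∀ (c : ℂ) ψ χ, b (c • ψ) χ = starRingEnd ℂ c • b ψ χ := fun c ψ χ => by
    refine tendsto_nhds_unique (hb _ χ) (((hb ψ χ).const_smul (starRingEnd ℂ c)).congr fun L => ?_)
    simp only [m, inner_smul_left, smul_eq_mul, mul_left_comm (k _)]
    exact (integral_const_mul _ _).symm
  have hsmul₂ : ∀ (c : ℂ) ψ χ, b ψ (c • χ) = c • b ψ χ := fun c ψ χ => by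
    refine tendsto_nhds_unique (hb ψ _) (((hb ψ χ).const_smul c).congr fun L => ?_)
    simp only [m, map_smul, inner_smul_right, smul_eq_mul, mul_left_comm (k _)]
    exact (integral_const_mul _ _).symm
  let β : H →L⋆[ℂ] H →L[ℂ] ℂ :=
    (LinearMap.mk₂'ₛₗ (starRingEnd ℂ) (RingHom.id ℂ) b hadd₁ hsmul₁ hadd₂ hsmul₂).mkContinuous₂
      ‖A‖ fun ψ χ => le_of_tendsto (hb ψ χ).norm (Eventually.of_forall fun L => hm L ψ χ)
  -- `T` stands on the left of the inner product, so it is the adjoint of the weak limit; this is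
  -- why `c` appears conjugated below.
  let T : H →L[ℂ] H := InnerProductSpace.continuousLinearMapOfBilin β
  have hT : ∀ ψ χ, inner ℂ (T ψ) χ = b ψ χ := fun ψ χ =>
    InnerProductSpace.continuousLinearMapOfBilin_apply β ψ χ
  have hcomm : ∀ C ∈ Q.localOperators, ∀ ψ χ, b ψ (C χ) = b (star C ψ) χ := fun C hC ψ χ =>
    sub_eq_zero.1 (tendsto_nhds_unique ((hb _ _).sub (hb _ _))
      ((Q.tendsto_integral_commutator hμ hj hfar hkc hk A hC ψ χ).mono_left h𝒰))
  obtain ⟨c, hc⟩ := Q.exists_eq_smul_of_commute_local (T := T) fun C hC => by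
    refine ContinuousLinearMap.ext fun ψ => ext_inner_right ℂ fun χ => ?_
    have h := hcomm (star C) (star_mem hC) ψ χ
    rw [star_star, ← hT, ← hT, ContinuousLinearMap.star_eq_adjoint,
      ContinuousLinearMap.adjoint_inner_right] at h
    exact h
  have hbc : ∀ ψ χ, b ψ χ = starRingEnd ℂ c * inner ℂ ψ χ := fun ψ χ => by
    rw [← hT, hc]
    simp [mul_comm]
  -- By invariance of `Ω` the integrand vanishes identically, so the weight `k` plays no role.
  have h0 : b Ω Ω = 0 := by
    refine tendsto_nhds_unique (hb Ω Ω) (tendsto_const_nhds.congr fun L => ?_)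
    have hz : ∀ x, inner ℂ Ω ((Q.translation x A : H →L[ℂ] H) Ω) = 0 := fun x =>
      (Q.inner_translation_vacuum hΩ x A).trans hA
    simp only [m, hz, mul_zero, integral_zero]
  have hc0 : starRingEnd ℂ c = 0 := by
    have h1 := hbc Ω Ω
    rw [h0, inner_self_eq_norm_sq_to_K, hΩ.1] at h1
    simpa using h1.symm
  have hfin := hb ψ χ
  rw [hbc, hc0, zero_mul] at hfin
  exact hfin

/-- The averages over spacelike regions of the observables with vanishing vacuum expectation value
tend to zero in all normal functionals. -/
theorem tendsto_integral_normal (hμ : ∀ L, μ L Set.univ ≤ 1) (hj : Continuous j)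
    (hfar : ∀ R, Tendsto (fun L => (μ L).real (j ⁻¹' nearRegion s R)) atTop (𝓝 0))
    (hkc : Continuous k) (hk : ∀ x, ‖k x‖ ≤ 1) {Ω : H} (hΩ : Q.IsVacuumVector Ω)
    {A : Q.algebra} (hA : A ∈ Q.kerVacuum Ω) (φ : Q.predual) :
    Tendsto (fun L => ∫ x, k x * (φ : StrongDual ℂ Q.algebra) (Q.translation (j x) A) ∂(μ L))
      atTop (𝓝 0) := by
  obtain ⟨φ, ψ, χ, hs, hφ⟩ := φ
  -- This majorant, uniform in `L`, justifies both the exchange of sum and integral and the termwise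
  -- limit.
  have hs' : Summable fun n => ‖A‖ * ‖ψ n‖ * ‖χ n‖ := by
    simpa only [mul_assoc] using hs.mul_left ‖A‖
  have hsum : ∀ L, ∫ x, k x * φ (Q.translation (j x) A) ∂(μ L) =
      ∑' n, ∫ x, k x * inner ℂ (ψ n) ((Q.translation (j x) A : H →L[ℂ] H) (χ n)) ∂(μ L) := by
    intro L
    have : IsFiniteMeasure (μ L) := ⟨(hμ L).trans_lt ENNReal.one_lt_top⟩
    have h := hasSum_integral_of_summable_integral_norm (μ := μ L)
      (F := fun n x => k x * inner ℂ (ψ n) ((Q.translation (j x) A : H →L[ℂ] H) (χ n)))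
      (fun n => Q.integrable_weight_mul_inner hμ hj hkc hk A _ _ L)
      (hs'.of_nonneg_of_le (fun n => integral_nonneg fun x => norm_nonneg _) fun n => by
        refine (integral_mono (Q.integrable_weight_mul_inner hμ hj hkc hk A _ _ L).norm
          (integrable_const _) (Q.norm_weight_mul_inner_le hk A (ψ n) (χ n))).trans ?_
        rw [integral_const, smul_eq_mul]
        exact mul_le_of_le_one_left (by positivity) (measure_real_le_one hμ L _))
    rw [h.tsum_eq]
    refine integral_congr_ae (Eventually.of_forall fun x => ?_)
    exact ((hφ (Q.translation (j x) A)).mul_left (k x)).tsum_eq.symm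
  have ht := tendsto_tsum_of_dominated_convergence (𝓕 := atTop) (g := fun _ => (0 : ℂ))
    (f := fun L n => ∫ x, k x * inner ℂ (ψ n)
      ((Q.translation (j x) A : H →L[ℂ] H) (χ n)) ∂(μ L)) hs'
    (fun n => Q.tendsto_integral_inner hμ hj hfar hkc hk hΩ hA (ψ n) (χ n))
    (Eventually.of_forall fun L n => norm_integral_le_of_bounded hμ L (by positivity)
      (Q.norm_weight_mul_inner_le hk A (ψ n) (χ n)))
  rw [tsum_zero] at ht
  exact ht.congr fun L => (hsum L).symm

end QuantumFieldTheory

/-! ### Averages over cuboids -/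

section Box

variable {d : ℕ}

/-- The normalized Lebesgue measure on the cuboid with half edge lengths `l`. -/
def boxMeasure (l : Fin d → ℝ) : Measure (Fin d → ℝ) :=
  (volume (Set.Icc (-l) l))⁻¹ • volume.restrict (Set.Icc (-l) l)

/-- The inequality, unlike equality, also holds for empty and degenerate cuboids, so no restriction
on `L` is needed. -/
theorem boxMeasure_univ_le_one (l : Fin d → ℝ) : boxMeasure l Set.univ ≤ 1 := by
  simp only [boxMeasure, Measure.smul_apply, Measure.restrict_apply_univ, smul_eq_mul]
  exact ENNReal.inv_mul_le_one _

theorem volume_Icc_neg_toReal {l : Fin d → ℝ} (hl : ∀ i, 0 ≤ l i) :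
    (volume (Set.Icc (-l) l)).toReal = ∏ i, (2 * l i) := by
  have h : -l ≤ l := fun i => (neg_nonpos.2 (hl i)).trans (hl i)
  rw [Real.volume_Icc_pi_toReal h]
  refine Finset.prod_congr rfl fun i _ => ?_
  rw [Pi.neg_apply]
  ring

theorem boxMeasure_real_le {l r : Fin d → ℝ} (hl : ∀ i, 0 < l i) (hr : ∀ i, 0 ≤ r i)
    {S : Set (Fin d → ℝ)} (hS : MeasurableSet S)
    (h : S ∩ Set.Icc (-l) l ⊆ Set.Icc (-r) r) :
    (boxMeasure l).real S ≤ ∏ i, (r i / l i) := by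
  have e : ∏ i, (r i / l i) =
      (volume (Set.Icc (-l) l)).toReal⁻¹ * (volume (Set.Icc (-r) r)).toReal := by
    rw [volume_Icc_neg_toReal fun i => (hl i).le, volume_Icc_neg_toReal hr, mul_comm,
      ← div_eq_mul_inv, ← Finset.prod_div_distrib]
    exact Finset.prod_congr rfl fun i _ => (mul_div_mul_left _ _ two_ne_zero).symm
  rw [e, measureReal_def, boxMeasure, Measure.smul_apply, smul_eq_mul, ENNReal.toReal_mul,
    ENNReal.toReal_inv, Measure.restrict_apply hS]
  gcongr
  exact isCompact_Icc.measure_ne_top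

theorem IsometryGroup.mean_eq_integral {E F : Type*} [NormedAddCommGroup E] [NormedSpace ℂ E]
    [NormedAddCommGroup F] [NormedSpace ℂ F] (α : IsometryGroup d E F)
    (B : LinearMap.BilinForm ℝ (Fin d → ℝ)) (l q : Fin d → ℝ) (φ : F) (A : E) :
    α.mean B l q φ A =
      ∫ x, Complex.exp (-Complex.I * (B q x : ℝ)) * α.pairing φ (α.act x A) ∂(boxMeasure l) := by
  rw [boxMeasure, integral_smul_measure, mean, ENNReal.toReal_inv, Complex.real_smul]

end Box

namespace QuantumFieldTheory

variable {s : ℕ} {H : Type*} [NormedAddCommGroup H] [InnerProductSpace ℂ H] [CompleteSpace H]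
  (Q : QuantumFieldTheory s H)

/-! ### Most of each large cuboid is far out in the spacelike directions -/

theorem tendsto_rpow_add_div {ε : ℝ} (hε : ε < 1) (R : ℝ) :
    Tendsto (fun L : ℝ => (L ^ ε + R) / L) atTop (𝓝 0) := by
  have h1 : Tendsto (fun L : ℝ => L ^ (-(1 - ε)) + R / L) atTop (𝓝 (0 + 0)) :=
    (tendsto_rpow_neg_atTop (by linarith)).add (tendsto_const_nhds.div_atTop tendsto_id)
  rw [add_zero] at h1
  refine h1.congr' ?_
  filter_upwards [eventually_gt_atTop 0] with L hL
  rw [add_div, neg_sub, Real.rpow_sub hL, Real.rpow_one]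

/-- In the cuboid `|x₀| ≤ L^ε`, so near points have space coordinates at most `L^ε + |R|`. They fill
at most the fraction `((L^ε + |R|)/L)^s`, which vanishes as `ε < 1` and `s ≥ 1`. -/
theorem tendsto_boxMeasure_spacetimeEdges (hs : 1 ≤ s) {ε : ℝ} (hε : ε < 1) (R : ℝ) :
    Tendsto (fun L => (boxMeasure (spacetimeEdges s ε L)).real (nearRegion s R)) atTop (𝓝 0) := by
  have ht := (tendsto_rpow_add_div hε |R|).pow s
  rw [zero_pow (by omega)] at ht
  refine squeeze_zero' (Eventually.of_forall fun L => measureReal_nonneg) ?_ ht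
  filter_upwards [eventually_gt_atTop 0] with L hL
  have hLε : 0 < L ^ ε := Real.rpow_pos_of_pos hL ε
  refine (boxMeasure_real_le (r := Fin.cons (L ^ ε) fun _ => L ^ ε + |R|) (fun i => ?_)
    (fun i => ?_) (isClosed_nearRegion s R).measurableSet ?_).trans (le_of_eq ?_)
  · refine Fin.cases ?_ (fun k => ?_) i
    · simpa [spacetimeEdges] using hLε
    · simpa [spacetimeEdges] using hL
  · refine Fin.cases ?_ (fun k => ?_) i
    · simpa using hLε.le
    · simp only [Fin.cons_succ]
      positivity
  · rintro x ⟨hx, hx₁, hx₂⟩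
    have h0 : |x 0| ≤ L ^ ε := abs_le.2 ⟨hx₁ 0, hx₂ 0⟩
    have hk : ∀ k : Fin s, |x k.succ| ≤ L ^ ε + |R| := fun k =>
      (hx k).trans (add_le_add h0 (le_abs_self R))
    refine ⟨fun i => ?_, fun i => ?_⟩
    · refine Fin.cases ?_ (fun k => ?_) i
      · exact (abs_le.1 h0).1
      · exact (abs_le.1 (hk k)).1
    · refine Fin.cases ?_ (fun k => ?_) i
      · exact (abs_le.1 h0).2
      · exact (abs_le.1 (hk k)).2
  · rw [Fin.prod_univ_succ]
    simp [spacetimeEdges, div_self hLε.ne', div_pow]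

/-- At time zero the near region is bounded, so its fraction is at most `(|R|/L)^s`. -/
theorem tendsto_boxMeasure_spaceEdges (hs : 1 ≤ s) (R : ℝ) :
    Tendsto (fun L => (boxMeasure (spaceEdges s L)).real
      (spaceEmbedding s ⁻¹' nearRegion s R)) atTop (𝓝 0) := by
  have ht : Tendsto (fun L : ℝ => (|R| / L) ^ s) atTop (𝓝 (0 ^ s)) :=
    (tendsto_const_nhds.div_atTop tendsto_id).pow s
  rw [zero_pow (by omega)] at ht
  refine squeeze_zero' (Eventually.of_forall fun L => measureReal_nonneg) ?_ ht
  filter_upwards [eventually_gt_atTop 0] with L hL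
  refine (boxMeasure_real_le (r := fun _ => |R|) (fun i => hL) (fun i => abs_nonneg R)
    ((isClosed_nearRegion s R).preimage
      (spaceEmbedding s).continuous_of_finiteDimensional).measurableSet ?_).trans (le_of_eq ?_)
  · rintro x ⟨hx, -⟩
    have hk : ∀ k, |x k| ≤ |R| := fun k => by
      have h := hx k
      simp only [spaceEmbedding, LinearMap.coe_mk, AddHom.coe_mk, Fin.cons_succ, Fin.cons_zero,
        abs_zero, zero_add] at h
      exact h.trans (le_abs_self R)
    exact ⟨fun k => (abs_le.1 (hk k)).1, fun k => (abs_le.1 (hk k)).2⟩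
  · simp [div_pow]

theorem minkowskiForm_nondegenerate (x : Fin (s + 1) → ℝ)
    (hx : ∀ p, minkowskiForm s p x = 0) : x = 0 := by
  funext i
  have h := hx (Pi.single i 1)
  simp only [minkowskiForm, LinearMap.mk₂_apply] at h
  revert h
  refine Fin.cases (fun h => ?_) (fun k h => ?_) i
  · simpa [Pi.single_apply, Fin.succ_ne_zero] using h
  · simpa [Pi.single_apply, (Fin.succ_ne_zero _).symm] using h

theorem spaceForm_nondegenerate (x : Fin s → ℝ) (hx : ∀ p, spaceForm s p x = 0) : x = 0 := by
  funext i
  have h := hx (Pi.single i 1)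
  simpa [spaceForm, Pi.single_apply] using h

/-! ### The spectral decomposition -/

theorem vacuumState_translation {Ω : H} (hΩ : Q.IsVacuumVector Ω) (x : Fin (s + 1) → ℝ)
    (A : Q.algebra) :
    (Q.vacuumState Ω : StrongDual ℂ Q.algebra) (Q.translation x A) =
      (Q.vacuumState Ω : StrongDual ℂ Q.algebra) A :=
  Q.inner_translation_vacuum hΩ x A

theorem vacuumState_one {Ω : H} (hΩ : Q.IsVacuumVector Ω) :
    (Q.vacuumState Ω : StrongDual ℂ Q.algebra) 1 = 1 := by
  change inner ℂ Ω Ω = (1 : ℂ)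
  rw [inner_self_eq_norm_sq_to_K, hΩ.1]
  simp

theorem translation_one (x : Fin (s + 1) → ℝ) : Q.translation x 1 = 1 := by
  ext1
  simp [translation]

/-- Vector functionals already separate: by polarization, a complex operator with vanishing
quadratic form is zero. -/
theorem eq_zero_of_predual (A : Q.algebra)
    (h : ∀ φ : Q.predual, (φ : StrongDual ℂ Q.algebra) A = 0) : A = 0 := by
  have h1 : ∀ v, inner ℂ (((A : H →L[ℂ] H) : H →ₗ[ℂ] H) v) v = (0 : ℂ) := fun v => by
    rw [← inner_conj_symm]
    have := h (Q.vacuumState v)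
    change inner ℂ v ((A : H →L[ℂ] H) v) = (0 : ℂ) at this
    change starRingEnd ℂ (inner ℂ v ((A : H →L[ℂ] H) v)) = 0
    rw [this, map_zero]
  have h2 := (inner_map_self_eq_zero _).1 h1
  ext v
  exact congrArg (fun f : H →ₗ[ℂ] H => f v) h2

set_option maxHeartbeats 1000000 in
/-- The decomposition for a group of translations `x ↦ α_{j x}` and averages over cuboids most of
whose points are far out in the spacelike directions. -/
theorem spectral_decomposition {d : ℕ} {Ω : H} (hΩ : Q.IsVacuumVector Ω)
    {j : (Fin d → ℝ) →ₗ[ℝ] (Fin (s + 1) → ℝ)} {l : ℝ → Fin d → ℝ}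
    (hl : ∀ᶠ L in atTop, ∀ i, 0 < l L i)
    (hfar : ∀ R, Tendsto (fun L => (boxMeasure (l L)).real (j ⁻¹' nearRegion s R)) atTop (𝓝 0))
    {B : LinearMap.BilinForm ℝ (Fin d → ℝ)} (hB : ∀ x, (∀ p, B p x = 0) → x = 0)
    {α : IsometryGroup d Q.algebra Q.predual} {α' : IsometryGroup d Q.predual Q.algebra}
    (hp : ∀ φ A, α.pairing φ A = (φ : StrongDual ℂ Q.algebra) A)
    (hp' : ∀ A φ, α'.pairing A φ = (φ : StrongDual ℂ Q.algebra) A)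
    (ha : ∀ x A, α.act x A = Q.translation (j x) A)
    (ha' : ∀ x φ A, (α'.act x φ : StrongDual ℂ Q.algebra) A =
      (φ : StrongDual ℂ Q.algebra) (Q.translation (j x) A)) :
    Q.kerVacuum Ω ≤ α.continuousSubspace B l ∧
      (IsCompl (α.purePointSubspace B) (α.continuousSubspace B l) ∧
        α.purePointSubspace B = Submodule.span ℂ {1} ∧
        α.continuousSubspace B l = Q.kerVacuum Ω) ∧
      (IsCompl (α'.purePointSubspace B) (α'.continuousSubspace B l) ∧
        α'.purePointSubspace B = Submodule.span ℂ {Q.vacuumState Ω} ∧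
        α'.continuousSubspace B l = Q.kerUnit) ∧
      α.continuousSpectrum B l = α'.continuousSpectrum B l := by
  have hmean : ∀ A ∈ Q.kerVacuum Ω, ∀ (q : Fin d → ℝ) (φ : Q.predual),
      Tendsto (fun L => ∫ x, Complex.exp (-Complex.I * (B q x : ℝ)) *
        (φ : StrongDual ℂ Q.algebra) (Q.translation (j x) A) ∂(boxMeasure (l L)))
        atTop (𝓝 0) := by
    intro A hA q φ
    have hBc : Continuous fun x => B q x := (B q).continuous_of_finiteDimensional
    refine Q.tendsto_integral_normal (fun L => boxMeasure_univ_le_one (l L))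
      j.continuous_of_finiteDimensional hfar (by fun_prop) (fun x => le_of_eq ?_) hΩ hA φ
    have e : -Complex.I * (B q x : ℝ) = ((-B q x : ℝ) : ℂ) * Complex.I := by push_cast; ring
    rw [e, Complex.norm_exp_ofReal_mul_I]
  have hk : LinearMap.ker (α.pairing (Q.vacuumState Ω)) = Q.kerVacuum Ω := by
    ext A
    rw [LinearMap.mem_ker, hp]
    rfl
  have hk' : LinearMap.ker (α'.pairing 1) = Q.kerUnit := by
    ext φ
    rw [LinearMap.mem_ker, hp']
    rfl
  have hone : α.pairing (Q.vacuumState Ω) 1 = 1 := by rw [hp, Q.vacuumState_one hΩ]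
  have hone' : α'.pairing 1 (Q.vacuumState Ω) = 1 := by rw [hp', Q.vacuumState_one hΩ]
  have hker : LinearMap.ker (α.pairing (Q.vacuumState Ω)) ≤ α.continuousSubspace B l := by
    intro A hA q φ
    refine (hmean A (hk ▸ hA) q φ).congr fun L => ?_
    simp only [α.mean_eq_integral, hp, ha]
  have hsub : ∀ A : Q.algebra,
      A - (Q.vacuumState Ω : StrongDual ℂ Q.algebra) A • 1 ∈ Q.kerVacuum Ω := fun A => by
    have h := IsometryGroup.sub_smul_mem_ker hone A
    rwa [hp, hk] at h
  have hsub' : ∀ φ : Q.predual,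
      φ - (φ : StrongDual ℂ Q.algebra) 1 • Q.vacuumState Ω ∈ Q.kerUnit := fun φ => by
    have h := IsometryGroup.sub_smul_mem_ker hone' φ
    rwa [hp', hk'] at h
  -- A functional that kills `I` does not see the projection of `A` onto `ker ω₀`. This transfers
  -- the convergence of means from `𝔄` to `𝔄_*`.
  have hshift : ∀ φ ∈ Q.kerUnit, ∀ A x, (φ : StrongDual ℂ Q.algebra) (Q.translation x
      (A - (Q.vacuumState Ω : StrongDual ℂ Q.algebra) A • 1)) =
        (φ : StrongDual ℂ Q.algebra) (Q.translation x A) := fun φ hφ A x => by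
    have h1 : (φ : StrongDual ℂ Q.algebra) 1 = 0 := hφ
    rw [map_sub, map_smul, translation_one, map_sub, map_smul, h1, smul_zero, sub_zero]
  have hker' : LinearMap.ker (α'.pairing 1) ≤ α'.continuousSubspace B l := by
    intro φ hφ q A
    refine (hmean _ (hsub A) q φ).congr fun L => ?_
    simp only [α'.mean_eq_integral, hp', ha', hshift φ (hk' ▸ hφ)]
  have hinv : ∀ x A, α.pairing (Q.vacuumState Ω) (α.act x A) = α.pairing (Q.vacuumState Ω) A :=
    fun x A => by rw [hp, hp, ha, Q.vacuumState_translation hΩ]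
  have hinv' : ∀ x φ, α'.pairing 1 (α'.act x φ) = α'.pairing 1 φ := fun x φ => by
    rw [hp', hp', ha', translation_one]
  have hc := (IsometryGroup.continuousSubspace_eq_ker hl hinv hker).trans hk
  have hc' := (IsometryGroup.continuousSubspace_eq_ker hl hinv' hker').trans hk'
  have hpp : α.purePointSubspace B = Submodule.span ℂ {1} :=
    IsometryGroup.purePointSubspace_eq_span hB hl (fun x => by rw [ha, translation_one]) hinv hone
      (fun A h => Q.eq_zero_of_predual A fun φ => (hp φ A).symm.trans (h φ)) hker
  have hpp' : α'.purePointSubspace B = Submodule.span ℂ {Q.vacuumState Ω} :=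
    IsometryGroup.purePointSubspace_eq_span hB hl
      (fun x => Subtype.ext (ContinuousLinearMap.ext fun A => by
        rw [ha', Q.vacuumState_translation hΩ])) hinv' hone'
      (fun φ h => Subtype.ext (ContinuousLinearMap.ext fun A => (hp' A φ).symm.trans (h A))) hker'
  refine ⟨hc.ge, ⟨?_, hpp, hc⟩, ⟨?_, hpp', hc'⟩, ?_⟩
  · rw [hpp, hc, ← hk]
    exact IsometryGroup.isCompl_span_ker hone
  · rw [hpp', hc', ← hk']
    exact IsometryGroup.isCompl_span_ker hone'
  · simp only [IsometryGroup.continuousSpectrum, IsometryGroup.spectrumOn, hc, hc', hp, hp', ha,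
      ha']
    congr 1
    -- The same function arises on both sides: replace `φ` by `φ - φ(I)ω₀` in one direction and `A`
    -- by `A - ω₀(A)I` in the other.
    refine Set.Subset.antisymm ?_ ?_
    · refine Set.iUnion₂_subset fun A hA => Set.iUnion_subset fun φ => ?_
      refine Set.Subset.trans (le_of_eq ?_) (Set.subset_iUnion₂_of_subset _ (hsub' φ)
        (Set.subset_iUnion_of_subset A subset_rfl))
      congr 1
      funext x
      have h0 : (Q.vacuumState Ω : StrongDual ℂ Q.algebra) A = 0 := hA
      simp [Q.vacuumState_translation hΩ, h0]
    · refine Set.iUnion₂_subset fun φ hφ => Set.iUnion_subset fun A => ?_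
      refine Set.Subset.trans (le_of_eq ?_) (Set.subset_iUnion₂_of_subset _ (hsub A)
        (Set.subset_iUnion_of_subset φ subset_rfl))
      congr 1
      funext x
      rw [hshift φ hφ]

end QuantumFieldTheory

end

/-! ### The theorem for spacetime and for space translations -/

theorem mainTheorem5 {s : ℕ} (hs : 1 ≤ s) {H : Type*} [NormedAddCommGroup H]
    [InnerProductSpace ℂ H] [CompleteSpace H] (Q : QuantumFieldTheory s H)
    (Ω : H) (hΩ : Q.IsVacuumVector Ω) (ε : ℝ) (hε₀ : 0 < ε) (hε₁ : ε < 1) :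
    (Q.kerVacuum Ω ≤ Q.spacetimeTranslations.continuousSubspace (minkowskiForm s) (spacetimeEdges s ε) ∧
      (IsCompl (Q.spacetimeTranslations.purePointSubspace (minkowskiForm s))
          (Q.spacetimeTranslations.continuousSubspace (minkowskiForm s) (spacetimeEdges s ε)) ∧
        Q.spacetimeTranslations.purePointSubspace (minkowskiForm s) = Submodule.span ℂ {1} ∧
        Q.spacetimeTranslations.continuousSubspace (minkowskiForm s) (spacetimeEdges s ε) = Q.kerVacuum Ω) ∧
      (IsCompl (Q.dualSpacetimeTranslations.purePointSubspace (minkowskiForm s))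
          (Q.dualSpacetimeTranslations.continuousSubspace (minkowskiForm s) (spacetimeEdges s ε)) ∧
        Q.dualSpacetimeTranslations.purePointSubspace (minkowskiForm s) = Submodule.span ℂ {Q.vacuumState Ω} ∧
        Q.dualSpacetimeTranslations.continuousSubspace (minkowskiForm s) (spacetimeEdges s ε) = Q.kerUnit) ∧
      Q.spacetimeTranslations.continuousSpectrum (minkowskiForm s) (spacetimeEdges s ε) =
        Q.dualSpacetimeTranslations.continuousSpectrum (minkowskiForm s) (spacetimeEdges s ε)) ∧
    (Q.kerVacuum Ω ≤ Q.spaceTranslations.continuousSubspace (spaceForm s) (spaceEdges s) ∧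
      (IsCompl (Q.spaceTranslations.purePointSubspace (spaceForm s))
          (Q.spaceTranslations.continuousSubspace (spaceForm s) (spaceEdges s)) ∧
        Q.spaceTranslations.purePointSubspace (spaceForm s) = Submodule.span ℂ {1} ∧
        Q.spaceTranslations.continuousSubspace (spaceForm s) (spaceEdges s) = Q.kerVacuum Ω) ∧
      (IsCompl (Q.dualSpaceTranslations.purePointSubspace (spaceForm s))
          (Q.dualSpaceTranslations.continuousSubspace (spaceForm s) (spaceEdges s)) ∧
        Q.dualSpaceTranslations.purePointSubspace (spaceForm s) = Submodule.span ℂ {Q.vacuumState Ω} ∧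
        Q.dualSpaceTranslations.continuousSubspace (spaceForm s) (spaceEdges s) = Q.kerUnit) ∧
      Q.spaceTranslations.continuousSpectrum (spaceForm s) (spaceEdges s) =
        Q.dualSpaceTranslations.continuousSpectrum (spaceForm s) (spaceEdges s)) := by
  refine ⟨Q.spectral_decomposition hΩ (j := LinearMap.id) ?_
      (QuantumFieldTheory.tendsto_boxMeasure_spacetimeEdges hs hε₁)
      QuantumFieldTheory.minkowskiForm_nondegenerate (fun _ _ => rfl) (fun _ _ => rfl)
      (fun _ _ => rfl) (fun _ _ _ => rfl),
    Q.spectral_decomposition hΩ (j := spaceEmbedding s) ?_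
      (QuantumFieldTheory.tendsto_boxMeasure_spaceEdges hs)
      QuantumFieldTheory.spaceForm_nondegenerate (fun _ _ => rfl) (fun _ _ => rfl)
      (fun _ _ => rfl) (fun _ _ _ => rfl)⟩
  · filter_upwards [eventually_gt_atTop 0] with L hL i
    refine Fin.cases ?_ (fun k => ?_) i
    · simpa [spacetimeEdges] using Real.rpow_pos_of_pos hL ε
    · simpa [spacetimeEdges] using hL
  · filter_upwards [eventually_gt_atTop 0] with L hL i
    exact hL
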